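/- **Setting.** The inputs are simple graphs $G$ on the vertex set $[n]$ with integer edge weights in $\{1,\dots,w\}$, where $w\ge 1$ and $w<n/2$. A randomized algorithm accesses $G$ by adjacency-list queries: a degree query $v\mapsto\deg(v)$, or a neighbor query $(v,i)\mapsto$ the $i$-th neighbor of $v$ together with the weight of the connecting edge, or $\perp$ if $i>\deg(v)$. The order of the lists is arbitrary. Two weighted graphs are edge-neighboring if there is one vertex pair $e$ such that, apart from $e$, they have the same edges with the same weights. The algorithm $\mathcal A'$ is $\varepsilon$-edge differentially private if $\Pr[\mathcal A'(G)\in S]\le e^{\varepsilon}\Pr[\mathcal A'(H)\in S]$ for all edge-neighboring $G,H$ (connected or not), all adjacency-list representations of them, and all measurable $S\subseteq\mathbb R$. For connected $G$ let $\mathsf M(G)$ be the weight of a minimum spanning tree of $G$, and let $\bar d=\bar d(G)=2|E(G)|/n$ be its average degree. Logarithms are natural. **Corollary.** For all $c>0$ and $\varepsilon_0>0$ there are constants $C',C>0$ and $N\in\mathbb N$ such that for all integers $K>0$, all $0<\varepsilon\le\varepsilon_0$, all $0<\alpha<1$ and all integers $n,w$ with $1\le w<n/2$ there is a randomized algorithm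 $\mathcal A'$ in the above query model such that: 1. (Privacy) $\mathcal A'$ is $\varepsilon$-edge differentially private. 2. (Accuracy) For every connected weighted graph $G$ on $n$ vertices with weights in $\{1,\dots,w\}$ (in any adjacency-list representation), with probability at least $1-\frac1{n^{c}}-\frac{1}{n^{c-3}(e^{\varepsilon}-1)/K+1}$, $$(1-\alpha')\,\mathsf M(G)-\frac{2cw\log n}{\varepsilon}-\frac1{Kn^3}\;\le\;\mathcal A'(G)\;\le\;(1+\alpha')\,\mathsf M(G)+\frac{2cw\log n}{\varepsilon}+\frac1{Kn^3},$$ where $\alpha'=\alpha\left(1+\frac{\varepsilon}{C'\log n}\right)$. 3. (Queries) If $n\ge N$, then for every such connected $G$, with probability at least $1-\frac1{n^c}$, $\mathcal A'$ makes at most $$C\cdot\bar d\,w\,\frac{\log^3 n}{\alpha^2\varepsilon^2}\,\log\!\left(\frac{\bar d\,w\log n}{\alpha\varepsilon}\right)$$ queries. -/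

import Mathlib

open MeasureTheory

/-- A simple graph on `n` vertices with integer edge weights in `{1, …, w}`
(the values of `weight` outside the edge set are irrelevant). -/
structure WeightedGraph (n w : ℕ) where
  graph : SimpleGraph (Fin n)
  weight : Sym2 (Fin n) → ℕ
  weight_mem : ∀ e ∈ graph.edgeSet, 1 ≤ weight e ∧ weight e ≤ w

namespace WeightedGraph

variable {n w : ℕ}

/-- The average degree `2m / n`. -/
noncomputable def avgDegree (G : WeightedGraph n w) : ℝ :=
  2 * (G.graph.edgeSet.ncard : ℝ) / (n : ℝ)

/-- The total weight of a set of edges. -/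
noncomputable def edgeWeight (G : WeightedGraph n w) (E : Set (Sym2 (Fin n))) : ℕ :=
  ∑ e ∈ E.toFinite.toFinset, G.weight e

/-- The weight of a minimum spanning tree (meaningful for connected graphs). -/
noncomputable def mstWeight (G : WeightedGraph n w) : ℕ :=
  sInf {m : ℕ | ∃ T : SimpleGraph (Fin n), T ≤ G.graph ∧ T.IsTree ∧ m = G.edgeWeight T.edgeSet}

/-- Two weighted graphs are edge-neighboring if, outside a single vertex pair `e`, they have
the same edges with the same weights; so `e` may be added, deleted or given a new weight. -/
def EdgeNeighboring (G H : WeightedGraph n w) : Prop :=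
  ∃ e : Sym2 (Fin n), ∀ e' : Sym2 (Fin n), e' ≠ e →
    ((e' ∈ G.graph.edgeSet ↔ e' ∈ H.graph.edgeSet) ∧
      (e' ∈ G.graph.edgeSet → G.weight e' = H.weight e'))

/-- An adjacency list representation: every vertex lists its neighbors, in some order. -/
structure AdjList (G : WeightedGraph n w) where
  nbrs : Fin n → List (Fin n)
  nodup : ∀ v, (nbrs v).Nodup
  mem_nbrs : ∀ v u, u ∈ nbrs v ↔ G.graph.Adj v u

/-- Answer to a degree query. -/
def AdjList.degree {G : WeightedGraph n w} (L : G.AdjList) (v : Fin n) : ℕ :=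
  (L.nbrs v).length

/-- Answer to a neighbor query: the neighbor of `v` at position `i` of its list (counted from
`0`) together with the weight of the connecting edge, or `none` if the list is too short. -/
def AdjList.neighbor {G : WeightedGraph n w} (L : G.AdjList) (v i : Fin n) :
    Option (Fin n × ℕ) :=
  ((L.nbrs v)[(i : ℕ)]?).map fun u => (u, G.weight s(v, u))

end WeightedGraph

/-- A deterministic adaptive algorithm in the adjacency list query model on `n` vertices, as a
decision tree: it outputs a real number, or asks a degree or a neighbor query and continues
depending on the answer. -/
inductive QueryTree (n : ℕ) : Type where
  | output (x : ℝ) : QueryTree n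
  | degreeQuery (v : Fin n) (next : ℕ → QueryTree n) : QueryTree n
  | neighborQuery (v i : Fin n) (next : Option (Fin n × ℕ) → QueryTree n) : QueryTree n

namespace QueryTree

variable {n w : ℕ} {G : WeightedGraph n w}

/-- The output on a given input. -/
def eval (L : G.AdjList) : QueryTree n → ℝ
  | output x => x
  | degreeQuery v next => eval L (next (L.degree v))
  | neighborQuery v i next => eval L (next (L.neighbor v i))

/-- The number of queries made on a given input. -/
def queries (L : G.AdjList) : QueryTree n → ℕ
  | output _ => 0
  | degreeQuery v next => queries L (next (L.degree v)) + 1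
  | neighborQuery v i next => queries L (next (L.neighbor v i)) + 1

end QueryTree

/-- A randomized query algorithm for `n`-vertex graphs with weights in `{1, …, w}`: random coins
drawn from a probability space, and a deterministic query algorithm for every outcome of the
coins. -/
structure QueryAlgorithm (n w : ℕ) where
  Coins : Type
  mCoins : MeasurableSpace Coins
  law : Measure Coins
  isProb : IsProbabilityMeasure law
  tree : Coins → QueryTree n
  measurable_eval : ∀ (G : WeightedGraph n w) (L : G.AdjList),
    Measurable fun r => (tree r).eval L
  measurable_queries : ∀ (G : WeightedGraph n w) (L : G.AdjList),
    Measurable fun r => (tree r).queries L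

namespace QueryAlgorithm

variable {n w : ℕ}

/-- The probability that the output on the given input lies in `S`. -/
noncomputable def probOutput (A : QueryAlgorithm n w) {G : WeightedGraph n w} (L : G.AdjList)
    (S : Set ℝ) : ℝ :=
  (@Measure.real A.Coins A.mCoins A.law {r | (A.tree r).eval L ∈ S})

/-- The probability that at most `B` queries are made on the given input. -/
noncomputable def probQueriesLE (A : QueryAlgorithm n w) {G : WeightedGraph n w} (L : G.AdjList)
    (B : ℝ) : ℝ :=
  (@Measure.real A.Coins A.mCoins A.law {r | ((A.tree r).queries L : ℝ) ≤ B})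

/-- `ε`-edge differential privacy, over all edge-neighboring weighted graphs (connected or not)
and all adjacency list representations of them. -/
def IsEdgeDP (A : QueryAlgorithm n w) (ε : ℝ) : Prop :=
  ∀ (G H : WeightedGraph n w), G.EdgeNeighboring H →
    ∀ (L : G.AdjList) (L' : H.AdjList) (S : Set ℝ), MeasurableSet S →
      A.probOutput L S ≤ Real.exp ε * A.probOutput L' S

end QueryAlgorithm

/-!
Let `c i` be the number of components of the subgraph of edges of weight at most `i`. By Kruskal's
algorithm, a minimum spanning tree weighs `∑ i < w, c i - w` (Chazelle, Rubinfeld and Trevisan). To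
estimate `∑ i < w, c i`, pick for each threshold many random vertices `u`, each with a random
exploration budget exceeding `x` with probability about `(deg u + 1) / x`. The component of `u` is
then explored completely with probability about `(deg u + 1) / vol`, where the volume `vol` of the
component is the sum of `deg v + 1` over its vertices `v`. As these ratios sum to `1` over a
component, `n` times the probability of such a hit is `c i`. Discarding a small proportion of the
samples, those with the largest budgets, loses few hits and truncates the heavy tail of the number
of queries.

For privacy, couple the samples on two neighboring graphs. The sum of the `c i` changes by at most
`w`, so that on the scale `z = log (1 + β * x / w) / β` an estimate with relative accuracy `β / 4`
moves by at most `1`, which Laplace noise of scale `1 / ε` hides. The relative accuracy fails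
with a small probability only; mixing in, with a small weight, Laplace noise centered at a grid of
all possible values hides that failure, which gives pure differential privacy.
-/

/-! ### Spanning forests and threshold graphs -/

section Forests

open SimpleGraph

variable {V : Type*}

theorem reachable_or_of_reachable_sup_edge {G : SimpleGraph V} {u v x y : V}
    (h : (G ⊔ edge u v).Reachable x y) :
    G.Reachable x y ∨ (G.Reachable x u ∧ G.Reachable v y) ∨
      (G.Reachable x v ∧ G.Reachable u y) := by
  obtain ⟨p⟩ := h
  induction p with
  | nil => exact .inl (.refl _)
  | cons hadj _ ih =>
    rw [sup_adj, edge_adj] at hadj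
    rcases hadj with hadj | ⟨⟨rfl, rfl⟩ | ⟨rfl, rfl⟩, _⟩
    · exact ih.imp hadj.reachable.trans
        (.imp (.imp_left hadj.reachable.trans) (.imp_left hadj.reachable.trans))
    · rcases ih with h | ⟨_, h⟩ | ⟨_, h⟩
      · exact .inr (.inl ⟨.refl _, h⟩)
      · exact .inr (.inl ⟨.refl _, h⟩)
      · exact .inl h
    · rcases ih with h | ⟨_, h⟩ | ⟨_, h⟩
      · exact .inr (.inr ⟨.refl _, h⟩)
      · exact .inl h
      · exact .inr (.inr ⟨.refl _, h⟩)

theorem card_connectedComponent_sup_edge_add_one [Finite V] {G : SimpleGraph V} {u v : V}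
    (h : ¬ G.Reachable u v) :
    Nat.card (G ⊔ edge u v).ConnectedComponent + 1 = Nat.card G.ConnectedComponent := by
  have hadj : (G ⊔ edge u v).Adj u v := by
    simp [edge_adj, show u ≠ v from fun huv => h (huv ▸ .refl _)]
  let merge : {c : G.ConnectedComponent // c ≠ G.connectedComponentMk v} →
      (G ⊔ edge u v).ConnectedComponent := fun c => c.1.map (Hom.ofLE le_sup_left)
  have hmerge : Function.Bijective merge := by
    constructor
    · rintro ⟨⟨x⟩, hx⟩ ⟨⟨y⟩, hy⟩ hxy
      refine Subtype.ext ?_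
      rcases reachable_or_of_reachable_sup_edge (ConnectedComponent.exact hxy) with
        h | ⟨_, hvy⟩ | ⟨hxv, _⟩
      · exact ConnectedComponent.sound h
      · exact absurd (ConnectedComponent.sound hvy.symm) hy
      · exact absurd (ConnectedComponent.sound hxv) hx
    · rintro ⟨x⟩
      by_cases hx : G.connectedComponentMk x = G.connectedComponentMk v
      · refine ⟨⟨G.connectedComponentMk u, fun huv => h (ConnectedComponent.exact huv)⟩, ?_⟩
        exact ConnectedComponent.sound
          (hadj.reachable.trans ((ConnectedComponent.exact hx).symm.mono le_sup_left))
      · exact ⟨⟨_, hx⟩, rfl⟩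
  rw [← Nat.card_eq_of_bijective merge hmerge]
  have hcard := Set.ncard_add_ncard_compl {G.connectedComponentMk v}
  rwa [Set.ncard_singleton, add_comm] at hcard

theorem card_connectedComponent_bot :
    Nat.card (⊥ : SimpleGraph V).ConnectedComponent = Nat.card V :=
  (Nat.card_eq_of_bijective (⊥ : SimpleGraph V).connectedComponentMk
    ⟨fun x y hxy => by simpa using ConnectedComponent.exact hxy, Quot.mk_surjective⟩).symm

theorem ncard_edgeSet_add_card_connectedComponent_of_isAcyclic [Finite V] {F : SimpleGraph V}
    (hF : F.IsAcyclic) : F.edgeSet.ncard + Nat.card F.ConnectedComponent = Nat.card V := by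
  induction hk : F.edgeSet.ncard generalizing F with
  | zero =>
    rw [Set.ncard_eq_zero, edgeSet_eq_empty] at hk
    rw [hk, zero_add, card_connectedComponent_bot]
  | succ k ih =>
    obtain ⟨⟨u, v⟩, he⟩ : F.edgeSet.Nonempty := by
      rw [← Set.ncard_pos]
      lia
    have hcard : Nat.card (F.deleteEdges {s(u, v)} ⊔ edge u v).ConnectedComponent + 1 = _ :=
      card_connectedComponent_sup_edge_add_one
        (isBridge_iff.1 (isAcyclic_iff_forall_isBridge.1 hF he))
    have hdel : (F.deleteEdges {s(u, v)}).edgeSet.ncard = k := by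
      rw [edgeSet_deleteEdges, Set.ncard_sdiff_singleton_of_mem he, hk, Nat.add_sub_cancel]
    have hsup : F.deleteEdges {s(u, v)} ⊔ edge u v = F :=
      sdiff_sup_cancel ((edge_le_iff F).2 (.inr he))
    rw [hsup] at hcard
    have := ih (hF.anti (deleteEdges_le _)) hdel
    lia

theorem ncard_edgeSet_add_card_connectedComponent_le_of_isAcyclic [Finite V] {F G : SimpleGraph V}
    (hF : F.IsAcyclic) (hle : F ≤ G) :
    F.edgeSet.ncard + Nat.card G.ConnectedComponent ≤ Nat.card V := by
  rw [← ncard_edgeSet_add_card_connectedComponent_of_isAcyclic hF]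
  gcongr
  exact ConnectedComponent.card_le_card_of_le hle

theorem card_connectedComponent_congr {F G : SimpleGraph V} (h : F.Reachable = G.Reachable) :
    Nat.card F.ConnectedComponent = Nat.card G.ConnectedComponent :=
  Nat.card_congr (Quot.congrRight fun a b => by rw [h])

theorem card_connectedComponent_le_add_one [Finite V] {G H : SimpleGraph V} {e : Sym2 V}
    (h : H.edgeSet \ {e} ⊆ G.edgeSet) :
    Nat.card G.ConnectedComponent ≤ Nat.card H.ConnectedComponent + 1 := by
  obtain ⟨F, hFH, hF, hreach⟩ := H.exists_isAcyclic_reachable_eq_le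
  have hle : F.deleteEdges {e} ≤ G := by
    rw [← edgeSet_subset_edgeSet, edgeSet_deleteEdges]
    exact (Set.sdiff_subset_sdiff_left (edgeSet_subset_edgeSet.2 hFH)).trans h
  have hcardF := ncard_edgeSet_add_card_connectedComponent_of_isAcyclic hF
  have hcardG := ncard_edgeSet_add_card_connectedComponent_le_of_isAcyclic
    (hF.anti (deleteEdges_le {e})) hle
  rw [card_connectedComponent_congr hreach] at hcardF
  rw [edgeSet_deleteEdges] at hcardG
  have := Set.pred_ncard_le_ncard_sdiff_singleton F.edgeSet e
  lia

end Forests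

namespace WeightedGraph

variable {n w : ℕ}

/-- The graph formed by the edges of weight at most `i`. -/
def threshold (G : WeightedGraph n w) (i : ℕ) : SimpleGraph (Fin n) where
  Adj u v := G.graph.Adj u v ∧ G.weight s(u, v) ≤ i
  symm := ⟨fun u v h => ⟨h.1.symm, by rw [Sym2.eq_swap]; exact h.2⟩⟩
  loopless := ⟨fun u h => G.graph.loopless.irrefl u h.1⟩

theorem mem_edgeSet_threshold (G : WeightedGraph n w) (i : ℕ) (e : Sym2 (Fin n)) :
    e ∈ (G.threshold i).edgeSet ↔ e ∈ G.graph.edgeSet ∧ G.weight e ≤ i := by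
  cases e
  rfl

theorem threshold_mono (G : WeightedGraph n w) : Monotone G.threshold :=
  fun _ _ hij _ _ huv => ⟨huv.1, huv.2.trans hij⟩

theorem threshold_le (G : WeightedGraph n w) (i : ℕ) : G.threshold i ≤ G.graph :=
  fun _ _ huv => huv.1

theorem threshold_zero (G : WeightedGraph n w) : G.threshold 0 = ⊥ :=
  eq_bot_iff.2 fun _ _ huv =>
    absurd (G.weight_mem _ huv.1).1 (Nat.not_le.2 (Nat.lt_succ_of_le huv.2))

theorem threshold_eq_graph (G : WeightedGraph n w) : G.threshold w = G.graph :=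
  (G.threshold_le w).antisymm fun _ _ huv => ⟨huv, (G.weight_mem _ huv).2⟩

/-- The number of connected components of the threshold graph at `i`, the `c⁽ⁱ⁾` of Chazelle,
Rubinfeld and Trevisan. -/
noncomputable def numComponents (G : WeightedGraph n w) (i : ℕ) : ℕ :=
  Nat.card (G.threshold i).ConnectedComponent

/-- The total number of components of the threshold graphs at `0, …, w - 1`. Unlike the weight of
a minimum spanning tree, it makes sense for disconnected graphs and changes by at most `w` when
a single edge is changed. -/
noncomputable def componentSum (G : WeightedGraph n w) : ℕ :=
  ∑ i ∈ Finset.range w, G.numComponents i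

theorem numComponents_zero (G : WeightedGraph n w) : G.numComponents 0 = n := by
  rw [numComponents, threshold_zero, card_connectedComponent_bot, Nat.card_fin]

theorem le_componentSum (G : WeightedGraph n w) (hw : 1 ≤ w) : n ≤ G.componentSum :=
  G.numComponents_zero.ge.trans
    (Finset.single_le_sum (f := G.numComponents) (fun _ _ => Nat.zero_le _)
      (Finset.mem_range.2 hw))

theorem EdgeNeighboring.symm {G H : WeightedGraph n w} (h : G.EdgeNeighboring H) :
    H.EdgeNeighboring G := by
  obtain ⟨e, he⟩ := h
  exact ⟨e, fun e' hne => ⟨(he e' hne).1.symm, fun h' =>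
    ((he e' hne).2 ((he e' hne).1.2 h')).symm⟩⟩

theorem EdgeNeighboring.numComponents_le {G H : WeightedGraph n w} (h : G.EdgeNeighboring H)
    (i : ℕ) : G.numComponents i ≤ H.numComponents i + 1 := by
  obtain ⟨e, he⟩ := h
  refine card_connectedComponent_le_add_one (e := e) fun e' ⟨h', hne⟩ => ?_
  rw [mem_edgeSet_threshold] at h' ⊢
  have hG := (he e' hne).1.2 h'.1
  exact ⟨hG, (he e' hne).2 hG ▸ h'.2⟩

theorem EdgeNeighboring.componentSum_le {G H : WeightedGraph n w} (h : G.EdgeNeighboring H) :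
    G.componentSum ≤ H.componentSum + w := by
  refine (Finset.sum_le_sum fun i _ => h.numComponents_le i).trans_eq ?_
  simp [Finset.sum_add_distrib, componentSum]

/-- The edges of `T` of weight at most `i`. -/
def lightEdges (G : WeightedGraph n w) (T : SimpleGraph (Fin n)) (i : ℕ) : Set (Sym2 (Fin n)) :=
  {e ∈ T.edgeSet | G.weight e ≤ i}

theorem lightEdges_mono (G : WeightedGraph n w) (i : ℕ) : Monotone (G.lightEdges · i) :=
  fun _ _ hST _ he => ⟨SimpleGraph.edgeSet_subset_edgeSet.2 hST he.1, he.2⟩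

theorem edgeWeight_add_sum_ncard_lightEdges (G : WeightedGraph n w) {T : SimpleGraph (Fin n)}
    (hT : T ≤ G.graph) :
    G.edgeWeight T.edgeSet + ∑ i ∈ Finset.range w, (G.lightEdges T i).ncard =
      w * T.edgeSet.ncard := by
  have hlight (i : ℕ) : (G.lightEdges T i).ncard =
      ∑ e ∈ T.edgeSet.toFinite.toFinset, if G.weight e ≤ i then 1 else 0 := by
    rw [Finset.sum_boole, Nat.cast_id, Set.ncard_eq_toFinset_card _]
    congr 1
    ext e
    simp [lightEdges]
  rw [edgeWeight, Finset.sum_congr rfl fun i _ => hlight i, Finset.sum_comm,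
    ← Finset.sum_add_distrib, Set.ncard_eq_toFinset_card _, mul_comm, ← smul_eq_mul]
  refine Finset.sum_eq_card_nsmul fun e he => ?_
  have hle : G.weight e ≤ w :=
    (G.weight_mem e (SimpleGraph.edgeSet_subset_edgeSet.2 hT (by simpa using he))).2
  have hIco : (Finset.range w).filter (G.weight e ≤ ·) = Finset.Ico (G.weight e) w := by
    ext i
    simp [and_comm]
  rw [Finset.sum_boole, Nat.cast_id, hIco, Nat.card_Ico, Nat.add_sub_cancel' hle]

theorem ncard_lightEdges_add_numComponents_le (G : WeightedGraph n w) {T : SimpleGraph (Fin n)}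
    (hT : T ≤ G.graph) (hA : T.IsAcyclic) (i : ℕ) :
    (G.lightEdges T i).ncard + G.numComponents i ≤ n := by
  have hcard := ncard_edgeSet_add_card_connectedComponent_le_of_isAcyclic
    (hA.anti (inf_le_left : T ⊓ G.threshold i ≤ T)) inf_le_right
  have hlight : G.lightEdges T i = (T ⊓ G.threshold i).edgeSet := by
    ext e
    have : e ∈ T.edgeSet → e ∈ G.graph.edgeSet := (SimpleGraph.edgeSet_subset_edgeSet.2 hT ·)
    simp only [lightEdges, Set.mem_ofPred_eq, SimpleGraph.edgeSet_inf, Set.mem_inter_iff,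
      mem_edgeSet_threshold]
    tauto
  rwa [Nat.card_fin, ← hlight] at hcard

theorem le_ncard_lightEdges_add_numComponents (G : WeightedGraph n w) {i : ℕ}
    {T : SimpleGraph (Fin n)} (hle : T ≤ G.threshold i) (hA : T.IsAcyclic)
    (hreach : T.Reachable = (G.threshold i).Reachable) :
    n ≤ (G.lightEdges T i).ncard + G.numComponents i := by
  have hcard := ncard_edgeSet_add_card_connectedComponent_of_isAcyclic hA
  rw [card_connectedComponent_congr hreach, Nat.card_fin] at hcard
  have hsub : T.edgeSet ⊆ G.lightEdges T i := fun e he => ⟨he,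
    ((G.mem_edgeSet_threshold i e).1 (SimpleGraph.edgeSet_subset_edgeSet.2 hle he)).2⟩
  exact hcard.ge.trans (Nat.add_le_add_right (Set.ncard_le_ncard hsub) _)

-- Kruskal's algorithm: a spanning forest of one threshold graph extends to one of the next.
theorem exists_isAcyclic_forall_le_ncard_lightEdges_add (G : WeightedGraph n w) (k : ℕ) :
    ∃ T ≤ G.threshold k, T.IsAcyclic ∧ T.Reachable = (G.threshold k).Reachable ∧
      ∀ i ≤ k, n ≤ (G.lightEdges T i).ncard + G.numComponents i := by
  induction k with
  | zero =>
    obtain ⟨T, hle, hA, hR⟩ := (G.threshold 0).exists_isAcyclic_reachable_eq_le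
    refine ⟨T, hle, hA, hR, fun i hi => ?_⟩
    obtain rfl := Nat.le_zero.1 hi
    exact G.le_ncard_lightEdges_add_numComponents hle hA hR
  | succ k ih =>
    obtain ⟨T, hle, hA, -, hT⟩ := ih
    obtain ⟨T', hTT', hle', hA', hR'⟩ :=
      SimpleGraph.exists_isAcyclic_reachable_eq_le_of_le_of_isAcyclic
        (hle.trans (G.threshold_mono k.le_succ)) hA
    refine ⟨T', hle', hA', hR', fun i hi => ?_⟩
    rcases hi.lt_or_eq with hi | rfl
    · refine (hT i (Nat.le_of_lt_succ hi)).trans ?_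
      gcongr
      · exact Set.toFinite _
      · exact G.lightEdges_mono i hTT'
    · exact G.le_ncard_lightEdges_add_numComponents hle' hA' hR'

theorem edgeWeight_add_add_sum_ncard_lightEdges (G : WeightedGraph n w)
    {T : SimpleGraph (Fin n)} (hle : T ≤ G.graph) (hT : T.IsTree) :
    G.edgeWeight T.edgeSet + w + ∑ i ∈ Finset.range w, (G.lightEdges T i).ncard = w * n := by
  have hcard : T.edgeSet.ncard + 1 = n := by
    classical
    have := hT.card_edgeFinset
    rwa [Fintype.card_fin, SimpleGraph.edgeFinset, ← Set.ncard_eq_toFinset_card'] at this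
  rw [add_right_comm, G.edgeWeight_add_sum_ncard_lightEdges hle, ← Nat.mul_succ,
    Nat.succ_eq_add_one, hcard]

theorem componentSum_le_edgeWeight_add (G : WeightedGraph n w) {T : SimpleGraph (Fin n)}
    (hle : T ≤ G.graph) (hT : T.IsTree) : G.componentSum ≤ G.edgeWeight T.edgeSet + w := by
  have hsum := Finset.sum_le_card_nsmul (Finset.range w) _ n fun i _ =>
    G.ncard_lightEdges_add_numComponents_le hle hT.isAcyclic i
  rw [Finset.sum_add_distrib, Finset.card_range, smul_eq_mul,
    ← G.edgeWeight_add_add_sum_ncard_lightEdges hle hT] at hsum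
  rw [componentSum]
  lia

theorem exists_isTree_edgeWeight_add_le_componentSum (G : WeightedGraph n w)
    (hG : G.graph.Connected) :
    ∃ T ≤ G.graph, T.IsTree ∧ G.edgeWeight T.edgeSet + w ≤ G.componentSum := by
  obtain ⟨T, hle, hA, hR, hlight⟩ := G.exists_isAcyclic_forall_le_ncard_lightEdges_add w
  rw [threshold_eq_graph] at hle hR
  have := hG.nonempty
  have hT : T.IsTree := ⟨⟨fun u v => hR ▸ hG.preconnected u v⟩, hA⟩
  have hsum := Finset.card_nsmul_le_sum (Finset.range w) _ n fun i hi =>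
    hlight i (Finset.mem_range.1 hi).le
  rw [Finset.sum_add_distrib, Finset.card_range, smul_eq_mul,
    ← G.edgeWeight_add_add_sum_ncard_lightEdges hle hT] at hsum
  refine ⟨T, hle, hT, ?_⟩
  rw [componentSum]
  lia

theorem mstWeight_add_eq_componentSum (G : WeightedGraph n w) (hG : G.graph.Connected) :
    G.mstWeight + w = G.componentSum := by
  obtain ⟨T, hle, hT, hweight⟩ := G.exists_isTree_edgeWeight_add_le_componentSum hG
  have hmem : G.edgeWeight T.edgeSet ∈ {m : ℕ | ∃ T : SimpleGraph (Fin n), T ≤ G.graph ∧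
      T.IsTree ∧ m = G.edgeWeight T.edgeSet} := ⟨T, hle, hT, rfl⟩
  apply le_antisymm
  · exact (Nat.add_le_add_right (Nat.sInf_le hmem) w).trans hweight
  · obtain ⟨T', hle', hT', hmst⟩ := Nat.sInf_mem ⟨_, hmem⟩
    rw [mstWeight, hmst]
    exact G.componentSum_le_edgeWeight_add hle' hT'

end WeightedGraph

/-! ### Query programs -/

/-- A deterministic query program that computes a value of an arbitrary type. -/
inductive QueryProg (n : ℕ) (α : Type) : Type where
  | ret (x : α) : QueryProg n α
  | degree (v : Fin n) (next : ℕ → QueryProg n α) : QueryProg n α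
  | neighbor (v i : Fin n) (next : Option (Fin n × ℕ) → QueryProg n α) : QueryProg n α

namespace QueryProg

variable {n w : ℕ} {α β ι : Type}

/-- The value computed on a given input. -/
def run {G : WeightedGraph n w} (L : G.AdjList) : QueryProg n α → α
  | ret x => x
  | degree v next => run L (next (L.degree v))
  | neighbor v i next => run L (next (L.neighbor v i))

/-- The number of queries made on a given input. -/
def cost {G : WeightedGraph n w} (L : G.AdjList) : QueryProg n α → ℕ
  | ret _ => 0
  | degree v next => cost L (next (L.degree v)) + 1
  | neighbor v i next => cost L (next (L.neighbor v i)) + 1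

/-- Sequential composition of query programs. -/
def bind : QueryProg n α → (α → QueryProg n β) → QueryProg n β
  | ret x, f => f x
  | degree v next, f => degree v fun d => (next d).bind f
  | neighbor v i next, f => neighbor v i fun o => (next o).bind f

instance : Monad (QueryProg n) where
  pure := ret
  bind := bind

/-- The decision tree that outputs `g x` when the program computes `x`. -/
def toTree (g : α → ℝ) : QueryProg n α → QueryTree n
  | ret x => .output (g x)
  | degree v next => .degreeQuery v fun d => (next d).toTree g
  | neighbor v i next => .neighborQuery v i fun o => (next o).toTree g

/-- Run a family of programs one after the other and collect the results; the indices outside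
`l` get a default value. -/
def gatherList [DecidableEq ι] [Inhabited α] (f : ι → QueryProg n α) :
    List ι → QueryProg n (ι → α)
  | [] => return default
  | i :: l => do
    let x ← f i
    let g ← gatherList f l
    return Function.update g i x

/-- Run the programs indexed by `s`, in some order, and collect the results. -/
noncomputable def gather [DecidableEq ι] [Inhabited α] (f : ι → QueryProg n α) (s : Finset ι) :
    QueryProg n (ι → α) :=
  gatherList f s.toList

variable {G : WeightedGraph n w} (L : G.AdjList)

@[simp]
theorem run_pure (x : α) : (pure x : QueryProg n α).run L = x :=
  rfl

@[simp]
theorem cost_pure (x : α) : (pure x : QueryProg n α).cost L = 0 :=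
  rfl

@[simp]
theorem run_degree_ret (v : Fin n) : (degree v ret).run L = L.degree v :=
  rfl

@[simp]
theorem cost_degree_ret (v : Fin n) : (degree v ret).cost L = 1 :=
  rfl

@[simp]
theorem run_neighbor_ret (v i : Fin n) : (neighbor v i ret).run L = L.neighbor v i :=
  rfl

@[simp]
theorem cost_neighbor_ret (v i : Fin n) : (neighbor v i ret).cost L = 1 :=
  rfl

@[simp]
theorem run_bind (p : QueryProg n α) (f : α → QueryProg n β) :
    (p >>= f).run L = (f (p.run L)).run L := by
  induction p with
  | ret x => rfl
  | degree v _ ih => exact ih _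
  | neighbor v i _ ih => exact ih _

@[simp]
theorem cost_bind (p : QueryProg n α) (f : α → QueryProg n β) :
    (p >>= f).cost L = p.cost L + (f (p.run L)).cost L := by
  induction p with
  | ret x => exact (Nat.zero_add _).symm
  | degree v _ ih => exact (congrArg (· + 1) (ih _)).trans (Nat.add_right_comm _ _ _)
  | neighbor v i _ ih => exact (congrArg (· + 1) (ih _)).trans (Nat.add_right_comm _ _ _)

theorem eval_toTree (g : α → ℝ) (p : QueryProg n α) : (p.toTree g).eval L = g (p.run L) := by
  induction p with
  | ret x => rfl
  | degree v _ ih => exact ih _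
  | neighbor v i _ ih => exact ih _

theorem queries_toTree (g : α → ℝ) (p : QueryProg n α) :
    (p.toTree g).queries L = p.cost L := by
  induction p with
  | ret x => rfl
  | degree v _ ih => exact congrArg (· + 1) (ih _)
  | neighbor v i _ ih => exact congrArg (· + 1) (ih _)

section Gather

variable [DecidableEq ι] [Inhabited α] (f : ι → QueryProg n α)

theorem run_gatherList {l : List ι} {i : ι} (hi : i ∈ l) :
    (gatherList f l).run L i = (f i).run L := by
  induction l with
  | nil => simp at hi
  | cons j l ih =>
    rcases eq_or_ne i j with rfl | hij
    · simp [gatherList]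
    · simpa [gatherList, hij] using ih ((List.mem_cons.1 hi).resolve_left hij)

theorem cost_gatherList (l : List ι) :
    (gatherList f l).cost L = (l.map fun i => (f i).cost L).sum := by
  induction l with
  | nil => rfl
  | cons j l ih => simp [gatherList, ih]

theorem run_gather {s : Finset ι} {i : ι} (hi : i ∈ s) :
    (gather f s).run L i = (f i).run L :=
  run_gatherList L f (Finset.mem_toList.2 hi)

theorem cost_gather (s : Finset ι) : (gather f s).cost L = ∑ i ∈ s, (f i).cost L := by
  rw [gather, cost_gatherList, Finset.sum_map_toList]

end Gather

/-- The endpoints of the edges of weight at most `i` found in the first `d` entries of the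
list of `v`. -/
noncomputable def lightNeighbors (i : ℕ) (v : Fin n) (d : ℕ) : QueryProg n (Finset (Fin n)) := do
  let slots : Finset (Fin n) := {j | (j : ℕ) < d}
  let entry ← gather (fun j => neighbor v j ret) slots
  return {u | ∃ j ∈ slots, ∃ x ≤ i, entry j = some (u, x)}

theorem cost_lightNeighbors_le (i : ℕ) (v : Fin n) (d : ℕ) :
    (lightNeighbors i v d).cost L ≤ d := by
  simp [lightNeighbors, cost_gather, Fin.card_filter_val_lt]

theorem mem_run_lightNeighbors_degree (i : ℕ) (v u : Fin n) :
    u ∈ (lightNeighbors i v (L.degree v)).run L ↔ (G.threshold i).Adj v u := by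
  have hentry : u ∈ (lightNeighbors i v (L.degree v)).run L ↔
      ∃ j : Fin n, (j : ℕ) < L.degree v ∧ ∃ x ≤ i, L.neighbor v j = some (u, x) := by
    simp only [lightNeighbors, run_bind, run_pure, Finset.mem_filter_univ]
    refine exists_congr fun j => and_congr_right fun hj => ?_
    rw [run_gather L _ (by simpa using hj), run_neighbor_ret]
  rw [hentry]
  constructor
  · rintro ⟨j, -, x, hx, h⟩
    obtain ⟨u', hu', h⟩ := Option.map_eq_some_iff.1 h
    obtain ⟨rfl, rfl⟩ := Prod.mk.inj h
    exact ⟨(L.mem_nbrs v u').1 (List.mem_of_getElem? hu'), hx⟩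
  · rintro ⟨hadj, hx⟩
    obtain ⟨j, hj, hju⟩ := List.mem_iff_getElem.1 ((L.mem_nbrs v u).2 hadj)
    have hlen : L.degree v ≤ n := by
      simpa [WeightedGraph.AdjList.degree] using (L.nodup v).length_le_card
    exact ⟨⟨j, hj.trans_le hlen⟩, hj, _, hx, by simp [WeightedGraph.AdjList.neighbor, hj, hju]⟩

/-- Explore a component of the graph of the edges of weight at most `i`: `visited` are the
vertices found so far, those in `done` have been processed and have volume `vol`. The result says
whether the whole component has volume at most `budget`. -/
noncomputable def explore (i budget : ℕ) (visited done : Finset (Fin n)) (vol : ℕ) :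
    QueryProg n Bool :=
  if h : ∃ v ∈ visited, v ∉ done then do
    let d ← degree h.choose ret
    if budget < vol + (d + 1) then return false
    let s ← lightNeighbors i h.choose d
    explore i budget (visited ∪ s) (insert h.choose done) (vol + (d + 1))
  else return true
termination_by doneᶜ.card
decreasing_by
  refine Finset.card_lt_card (Finset.compl_ssubset_compl.2 (Finset.ssubset_insert ?_))
  exact h.choose_spec.2

theorem cost_explore_add_le {i budget : ℕ} (visited done : Finset (Fin n)) {vol : ℕ}
    (hvol : vol ≤ budget) :
    (explore i budget visited done vol).cost L + vol ≤ budget + 1 := by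
  fun_induction explore i budget visited done vol with
  | case1 visited done vol h ih =>
    have hlight := cost_lightNeighbors_le L i h.choose (L.degree h.choose)
    rw [cost_bind, cost_degree_ret, run_degree_ret]
    split_ifs with hb
    · rw [cost_pure]
      lia
    · rw [cost_bind]
      have := ih (L.degree h.choose) ((lightNeighbors i h.choose (L.degree h.choose)).run L)
        (not_lt.1 hb)
      lia
  | case2 => simp [hvol.trans (Nat.le_succ _)]

end QueryProg

namespace WeightedGraph.AdjList

variable {n w : ℕ} {G : WeightedGraph n w}

/-- The volume of a set of vertices: the number of its vertices plus the sum of their degrees. -/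
def volume (L : G.AdjList) (s : Finset (Fin n)) : ℕ :=
  ∑ v ∈ s, (L.degree v + 1)

theorem volume_mono (L : G.AdjList) : Monotone L.volume :=
  fun _ _ hst => Finset.sum_le_sum_of_subset hst

open Classical in
/-- The volume, with respect to the degrees in the whole graph, of the component of `u` in the
graph of the edges of weight at most `i`. -/
noncomputable def componentVolume (L : G.AdjList) (i : ℕ) (u : Fin n) : ℕ :=
  L.volume {v | (G.threshold i).Reachable u v}

/-- The invariant of the exploration of the component of `u` in the threshold graph at `i`. -/
structure IsExploration (L : G.AdjList) (i : ℕ) (u : Fin n) (visited done : Finset (Fin n)) :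
    Prop where
  mem_visited : u ∈ visited
  done_subset : done ⊆ visited
  reachable : ∀ v ∈ visited, (G.threshold i).Reachable u v
  mem_of_adj : ∀ v ∈ done, ∀ x, (G.threshold i).Adj v x → x ∈ visited

namespace IsExploration

variable {L : G.AdjList} {i : ℕ} {u : Fin n} {visited done : Finset (Fin n)}

theorem singleton_empty (L : G.AdjList) (i : ℕ) (u : Fin n) : L.IsExploration i u {u} ∅ :=
  ⟨by simp, by simp, by simp, by simp⟩

theorem union_insert (h : L.IsExploration i u visited done) {v : Fin n} (hv : v ∈ visited)
    {s : Finset (Fin n)} (hs : ∀ x, x ∈ s ↔ (G.threshold i).Adj v x) :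
    L.IsExploration i u (visited ∪ s) (insert v done) where
  mem_visited := Finset.mem_union_left _ h.mem_visited
  done_subset := Finset.insert_subset (Finset.mem_union_left _ hv)
    (h.done_subset.trans Finset.subset_union_left)
  reachable x hx := (Finset.mem_union.1 hx).elim (h.reachable x) fun hx =>
    (h.reachable v hv).trans ((hs x).1 hx).reachable
  mem_of_adj x hx y hy := by
    rcases Finset.mem_insert.1 hx with rfl | hx
    · exact Finset.mem_union_right _ ((hs y).2 hy)
    · exact Finset.mem_union_left _ (h.mem_of_adj x hx y hy)

theorem volume_le_componentVolume (h : L.IsExploration i u visited done) {s : Finset (Fin n)}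
    (hs : s ⊆ visited) : L.volume s ≤ L.componentVolume i u :=
  L.volume_mono fun x hx => by simpa using h.reachable x (hs hx)

theorem componentVolume_eq (h : L.IsExploration i u visited done) (hdone : visited ⊆ done) :
    L.componentVolume i u = L.volume done := by
  refine (h.volume_le_componentVolume h.done_subset).antisymm'
    (L.volume_mono fun x hx => hdone ?_)
  obtain ⟨p⟩ : (G.threshold i).Reachable u x := by simpa using hx
  have hclosed {x y : Fin n} (p : (G.threshold i).Walk x y) : x ∈ visited → y ∈ visited := by
    induction p with
    | nil => exact id
    | cons hadj _ ih => exact fun hx => ih (h.mem_of_adj _ (hdone hx) _ hadj)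
  exact hclosed p h.mem_visited

end IsExploration

end WeightedGraph.AdjList

namespace QueryProg

variable {n w : ℕ} {G : WeightedGraph n w} (L : G.AdjList)

theorem run_explore {i budget : ℕ} {u : Fin n} {visited done : Finset (Fin n)} {vol : ℕ}
    (h : L.IsExploration i u visited done) (hvol : vol = L.volume done) (hle : vol ≤ budget) :
    (explore i budget visited done vol).run L = decide (L.componentVolume i u ≤ budget) := by
  fun_induction explore i budget visited done vol with
  | case1 visited done vol hne ih =>
    obtain ⟨hv, hv'⟩ := hne.choose_spec
    have hinsert : L.volume (insert hne.choose done) = vol + (L.degree hne.choose + 1) := by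
      rw [WeightedGraph.AdjList.volume, Finset.sum_insert hv', hvol, add_comm]
      rfl
    rw [run_bind, run_degree_ret]
    split_ifs with hb
    · have := h.volume_le_componentVolume (Finset.insert_subset hv h.done_subset)
      simp only [run_pure, Bool.false_eq, decide_eq_false_iff_not, not_le]
      lia
    · rw [run_bind]
      exact ih _ _ (h.union_insert hv (mem_run_lightNeighbors_degree L i hne.choose))
        hinsert.symm (not_lt.1 hb)
  | case2 visited done vol hne =>
    push Not at hne
    simp [h.componentVolume_eq hne, ← hvol, hle]

end QueryProg

section Discard

variable {ι M : Type*} [Fintype ι] [DecidableEq ι] [AddCommMonoid M] [LinearOrder M]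

theorem exists_card_le_forall_sum_compl_le (k : ℕ) (b : ι → M) :
    ∃ J : Finset ι, J.card ≤ k ∧
      ∀ J' : Finset ι, J'.card ≤ k → ∑ i ∈ Jᶜ, b i ≤ ∑ i ∈ J'ᶜ, b i := by
  obtain ⟨J, hJ, hmin⟩ := Finset.exists_min_image {J : Finset ι | J.card ≤ k}
    (fun J => ∑ i ∈ Jᶜ, b i) ⟨∅, by simp⟩
  exact ⟨J, by simpa using hJ, fun J' hJ' => hmin J' (by simpa using hJ')⟩

/-- A set of at most `k` indices whose removal makes the sum of the remaining values of `b` as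
small as possible. -/
noncomputable def discarded (k : ℕ) (b : ι → M) : Finset ι :=
  (exists_card_le_forall_sum_compl_le k b).choose

theorem card_discarded_le (k : ℕ) (b : ι → M) : (discarded k b).card ≤ k :=
  (exists_card_le_forall_sum_compl_le k b).choose_spec.1

theorem sum_compl_discarded_le {k : ℕ} (b : ι → M) {J : Finset ι} (hJ : J.card ≤ k) :
    ∑ i ∈ (discarded k b)ᶜ, b i ≤ ∑ i ∈ Jᶜ, b i :=
  (exists_card_le_forall_sum_compl_le k b).choose_spec.2 J hJ

end Discard

/-- The exploration budget of the sample `s = (u, a)`, where `d` is the degree of `u`. For uniform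
`a`, the budget is at least `x ≤ Q` times `d + 1` with probability about `1 / x`. -/
def sampleBudget {n Q : ℕ} (s : Fin n × Fin Q) (d : ℕ) : ℕ :=
  Q * (d + 1) / (s.2 + 1)

namespace WeightedGraph.AdjList

variable {n w Q : ℕ} {G : WeightedGraph n w}

/-- A sample is a hit at threshold `i` if its budget suffices to explore its component. -/
def IsHit (L : G.AdjList) (i : ℕ) (s : Fin n × Fin Q) : Prop :=
  L.componentVolume i s.1 ≤ sampleBudget s (L.degree s.1)

end WeightedGraph.AdjList

namespace QueryProg

variable {n w Q : ℕ} {ι : Type} [Fintype ι] [DecidableEq ι]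

/-- Count the samples `s j` that are hits at the threshold `i j`, after discarding `k` samples
with large budgets to keep the number of queries under control. -/
noncomputable def countHits (k : ℕ) (i : ι → ℕ) (s : ι → Fin n × Fin Q) : QueryProg n ℕ := do
  let deg ← gather (fun j => degree (s j).1 ret) Finset.univ
  let budget := fun j => sampleBudget (s j) (deg j)
  let kept := (discarded k budget)ᶜ
  let isHit ← gather (fun j => explore (i j) (budget j) {(s j).1} ∅ 0) kept
  return {j ∈ kept | isHit j}.card

variable {G : WeightedGraph n w} (L : G.AdjList) (k : ℕ) (i : ι → ℕ) (s : ι → Fin n × Fin Q)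

theorem run_gather_degree :
    (gather (fun j => degree (s j).1 ret) Finset.univ).run L = fun j => L.degree (s j).1 := by
  funext j
  rw [run_gather L _ (Finset.mem_univ j), run_degree_ret]

open Classical in
theorem run_countHits :
    (countHits k i s).run L =
      {j ∈ (discarded k fun j => sampleBudget (s j) (L.degree (s j).1))ᶜ |
        L.IsHit (i j) (s j)}.card := by
  simp only [countHits, run_bind, run_pure, run_gather_degree]
  refine congrArg Finset.card (Finset.filter_congr fun j hj => ?_)
  rw [run_gather L _ hj, run_explore L (.singleton_empty L (i j) (s j).1) (by rfl) (Nat.zero_le _),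
    decide_eq_true_iff]
  rfl

open Classical in
theorem run_countHits_le :
    (countHits k i s).run L ≤ ({j | L.IsHit (i j) (s j)} : Finset ι).card := by
  rw [run_countHits]
  exact Finset.card_le_card (Finset.filter_subset_filter _ (Finset.subset_univ _))

open Classical in
theorem card_isHit_le_run_countHits_add :
    ({j | L.IsHit (i j) (s j)} : Finset ι).card ≤ (countHits k i s).run L + k := by
  rw [run_countHits]
  set J := discarded k fun j => sampleBudget (s j) (L.degree (s j).1)
  calc ({j | L.IsHit (i j) (s j)} : Finset ι).card
      ≤ ({j ∈ Jᶜ | L.IsHit (i j) (s j)} ∪ J).card := Finset.card_le_card fun j hj => by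
        by_cases hJ : j ∈ J <;> simp_all
    _ ≤ _ := (Finset.card_union_le _ _).trans (Nat.add_le_add_left (card_discarded_le k _) _)

theorem cost_countHits_le {J : Finset ι} (hJ : J.card ≤ k) :
    (countHits k i s).cost L ≤
      2 * Fintype.card ι + ∑ j ∈ Jᶜ, sampleBudget (s j) (L.degree (s j).1) := by
  simp only [countHits, cost_bind, run_gather_degree, cost_pure, cost_gather, cost_degree_ret]
  calc _ ≤ ∑ _j : ι, 1 + ∑ j ∈ (discarded k fun j => sampleBudget (s j) (L.degree (s j).1))ᶜ,
        (sampleBudget (s j) (L.degree (s j).1) + 1) :=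
        Nat.add_le_add_left (Finset.sum_le_sum fun j _ =>
          cost_explore_add_le L {(s j).1} ∅ (Nat.zero_le _)) _
    _ ≤ Fintype.card ι + (∑ j ∈ Jᶜ, sampleBudget (s j) (L.degree (s j).1) + Fintype.card ι) := by
        rw [Finset.sum_add_distrib, Finset.sum_const, smul_eq_mul, mul_one, Finset.sum_const,
          smul_eq_mul, mul_one, Finset.card_univ]
        gcongr _ + (?_ + ?_)
        · exact sum_compl_discarded_le _ hJ
        · exact Finset.card_le_univ _
    _ = _ := by ring

end QueryProg

namespace QueryAlgorithm

variable {n w : ℕ} {Ω ι : Type} [MeasurableSpace Ω] [DiscreteMeasurableSpace Ω] [Countable Ω]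

/-- The algorithm that runs a program `prog ω` with random coins `ω` and then outputs a random real
number whose law `κ x` depends on the result `x` of the program. The coins comprise one independent
real number for each possible result. -/
noncomputable def ofProg (w : ℕ) (P : Measure Ω) [IsProbabilityMeasure P] (prog : Ω → QueryProg n ι)
    (κ : ι → Measure ℝ) [∀ x, IsProbabilityMeasure (κ x)] : QueryAlgorithm n w where
  Coins := Ω × (ι → ℝ)
  mCoins := inferInstance
  law := P.prod (Measure.infinitePi κ)
  isProb := inferInstance
  tree r := (prog r.1).toTree r.2
  measurable_eval G L := by
    simp only [QueryProg.eval_toTree]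
    exact measurable_from_prod_countable_right fun ω =>
      measurable_pi_apply ((prog ω).run L)
  measurable_queries G L := by
    simp only [QueryProg.queries_toTree]
    exact (Measurable.of_discrete (f := fun ω => (prog ω).cost L)).comp measurable_fst

variable (P : Measure Ω) [IsProbabilityMeasure P] (prog : Ω → QueryProg n ι)
  (κ : ι → Measure ℝ) [∀ x, IsProbabilityMeasure (κ x)] {G : WeightedGraph n w} (L : G.AdjList)

theorem probOutput_ofProg {S : Set ℝ} (hS : MeasurableSet S) :
    (ofProg w P prog κ).probOutput L S = ∫ ω, (κ ((prog ω).run L)).real S ∂P := by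
  have hmeas : MeasurableSet {r : Ω × (ι → ℝ) | r.2 ((prog r.1).run L) ∈ S} :=
    (measurable_from_prod_countable_right fun ω => measurable_pi_apply ((prog ω).run L)) hS
  have hlaw (x : ι) : Measure.infinitePi κ {f | f x ∈ S} = κ x S :=
    (measurePreserving_eval_infinitePi κ x).measure_preimage hS.nullMeasurableSet
  change (P.prod (Measure.infinitePi κ)).real {r | ((prog r.1).toTree r.2).eval L ∈ S} = _
  simp only [QueryProg.eval_toTree, measureReal_def]
  rw [Measure.prod_apply hmeas, integral_toReal .of_discrete (.of_forall fun _ => by finiteness)]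
  exact congrArg _ (lintegral_congr fun ω => hlaw ((prog ω).run L))

theorem probQueriesLE_ofProg (B : ℝ) :
    (ofProg w P prog κ).probQueriesLE L B = P.real {ω | ((prog ω).cost L : ℝ) ≤ B} := by
  change (P.prod (Measure.infinitePi κ)).real {r | (((prog r.1).toTree r.2).queries L : ℝ) ≤ B} = _
  simp only [QueryProg.queries_toTree]
  exact measurePreserving_fst.measureReal_preimage (s := {ω | ((prog ω).cost L : ℝ) ≤ B})
    (MeasurableSet.of_discrete).nullMeasurableSet

end QueryAlgorithm

/-! ### Concentration -/

section Chernoff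

open ProbabilityTheory

variable {Ω ι : Type*} [MeasurableSpace Ω] {P : Measure Ω} {X : ι → Ω → ℝ}

theorem exp_mul_le_of_mem_Icc {y : ℝ} (hy : y ∈ Set.Icc 0 1) (t : ℝ) :
    Real.exp (t * y) ≤ 1 + (Real.exp t - 1) * y := by
  have hconv := convexOn_exp.2 (Set.mem_univ 0) (Set.mem_univ t) (sub_nonneg.2 hy.2) hy.1 (by ring)
  simp only [smul_eq_mul, mul_zero, zero_add, Real.exp_zero] at hconv
  rw [mul_comm t y]
  linarith

theorem mgf_le_exp_of_mem_Icc [IsProbabilityMeasure P] {Y : Ω → ℝ} (hY : AEMeasurable Y P)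
    (hIcc : ∀ᵐ ω ∂P, Y ω ∈ Set.Icc 0 1) (t : ℝ) :
    mgf Y P t ≤ Real.exp ((Real.exp t - 1) * P[Y]) := by
  have h_int : Integrable Y P := .of_mem_Icc 0 1 hY hIcc
  calc mgf Y P t ≤ ∫ ω, (1 + (Real.exp t - 1) * Y ω) ∂P :=
        integral_mono_ae (integrable_exp_mul_of_mem_Icc hY hIcc)
          ((integrable_const _).add (h_int.const_mul _))
          (hIcc.mono fun _ hω => exp_mul_le_of_mem_Icc hω t)
    _ = (Real.exp t - 1) * P[Y] + 1 := by
        rw [integral_add (integrable_const _) (h_int.const_mul _), integral_const_mul,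
          integral_const, probReal_univ, one_smul, add_comm]
    _ ≤ _ := Real.add_one_le_exp _

variable [Fintype ι]

section Tail

variable (hindep : iIndepFun X P) (hmeas : ∀ i, Measurable (X i))
  (hIcc : ∀ i, ∀ᵐ ω ∂P, X i ω ∈ Set.Icc 0 1)
include hindep hmeas hIcc

theorem integrable_exp_mul_sum_of_mem_Icc (t : ℝ) :
    Integrable (fun ω => Real.exp (t * (∑ i, X i) ω)) P := by
  have := hindep.isProbabilityMeasure
  exact hindep.integrable_exp_mul_sum hmeas fun i _ =>
    integrable_exp_mul_of_mem_Icc (hmeas i).aemeasurable (hIcc i)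

theorem mgf_sum_le_exp_of_mem_Icc (t : ℝ) :
    mgf (∑ i, X i) P t ≤ Real.exp ((Real.exp t - 1) * ∑ i, P[X i]) := by
  have := hindep.isProbabilityMeasure
  rw [hindep.mgf_sum hmeas, Finset.mul_sum, Real.exp_sum]
  exact Finset.prod_le_prod (fun _ _ => mgf_nonneg) fun i _ =>
    mgf_le_exp_of_mem_Icc (hmeas i).aemeasurable (hIcc i) t

theorem measureReal_le_sum_le_exp {t : ℝ} (ht : 0 ≤ t) (x : ℝ) :
    P.real {ω | x ≤ ∑ i, X i ω} ≤ Real.exp ((Real.exp t - 1) * ∑ i, P[X i] - t * x) := by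
  have := hindep.isProbabilityMeasure
  have h := (measure_ge_le_exp_mul_mgf x ht
    (integrable_exp_mul_sum_of_mem_Icc hindep hmeas hIcc t)).trans
    (mul_le_mul_of_nonneg_left (mgf_sum_le_exp_of_mem_Icc hindep hmeas hIcc t) (Real.exp_pos _).le)
  rw [← Real.exp_add] at h
  simp only [Finset.sum_apply] at h
  exact h.trans_eq (by ring_nf)

theorem measureReal_sum_le_le_exp {t : ℝ} (ht : t ≤ 0) (x : ℝ) :
    P.real {ω | ∑ i, X i ω ≤ x} ≤ Real.exp ((Real.exp t - 1) * ∑ i, P[X i] - t * x) := by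
  have := hindep.isProbabilityMeasure
  have h := (measure_le_le_exp_mul_mgf x ht
    (integrable_exp_mul_sum_of_mem_Icc hindep hmeas hIcc t)).trans
    (mul_le_mul_of_nonneg_left (mgf_sum_le_exp_of_mem_Icc hindep hmeas hIcc t) (Real.exp_pos _).le)
  rw [← Real.exp_add] at h
  simp only [Finset.sum_apply] at h
  exact h.trans_eq (by ring_nf)

omit hindep hmeas hIcc in
theorem exp_sub_one_mul_sub_le {γ ρ μ t : ℝ} (hγ : γ ≤ 1) (hμ : 0 ≤ μ) (ht : |t| = γ / 2) :
    (Real.exp t - 1) * μ - (t * μ + γ / 2 * (γ * (ρ + μ))) ≤ -(γ ^ 2 * ρ / 2) := by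
  have hexp := (abs_le.1 (Real.abs_exp_sub_one_sub_id_le (x := t) (by rw [ht]; linarith))).2
  have ht2 : t ^ 2 = γ ^ 2 / 4 := by rw [← sq_abs, ht]; ring
  have hquad : (Real.exp t - 1 - t) * μ ≤ γ ^ 2 / 4 * μ :=
    mul_le_mul_of_nonneg_right (ht2 ▸ hexp) hμ
  nlinarith [mul_nonneg (sq_nonneg γ) hμ]

theorem measureReal_lt_abs_sum_sub_le {γ ρ : ℝ} (hγ0 : 0 ≤ γ) (hγ1 : γ ≤ 1) :
    P.real {ω | γ * (ρ + ∑ i, P[X i]) < |∑ i, X i ω - ∑ i, P[X i]|} ≤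
      2 * Real.exp (-(γ ^ 2 * ρ / 2)) := by
  have := hindep.isProbabilityMeasure
  have hγ2 : 0 ≤ γ / 2 := by positivity
  set μ := ∑ i, P[X i]
  have hμ0 : 0 ≤ μ := Finset.sum_nonneg fun i _ =>
    integral_nonneg_of_ae ((hIcc i).mono fun _ hω => hω.1)
  have hup : P.real {ω | μ + γ * (ρ + μ) ≤ ∑ i, X i ω} ≤ Real.exp (-(γ ^ 2 * ρ / 2)) := by
    refine (measureReal_le_sum_le_exp hindep hmeas hIcc hγ2 _).trans
      (Real.exp_le_exp.2 ?_)
    rw [mul_add]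
    exact exp_sub_one_mul_sub_le hγ1 hμ0 (abs_of_nonneg hγ2)
  have hdown : P.real {ω | ∑ i, X i ω ≤ μ - γ * (ρ + μ)} ≤ Real.exp (-(γ ^ 2 * ρ / 2)) := by
    refine (measureReal_sum_le_le_exp hindep hmeas hIcc
      (neg_nonpos.2 hγ2) _).trans (Real.exp_le_exp.2 ?_)
    rw [mul_sub, neg_mul, neg_mul, sub_neg_eq_add, ← neg_mul]
    exact exp_sub_one_mul_sub_le hγ1 hμ0 (by rw [abs_neg, abs_of_nonneg hγ2])
  calc P.real {ω | γ * (ρ + μ) < |∑ i, X i ω - μ|}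
    _ ≤ P.real ({ω | μ + γ * (ρ + μ) ≤ ∑ i, X i ω} ∪ {ω | ∑ i, X i ω ≤ μ - γ * (ρ + μ)}) :=
        measureReal_mono fun ω hω => (lt_abs.1 (Set.mem_ofPred_eq ▸ hω)).imp
          (fun h => by dsimp; linarith) fun h => by dsimp; linarith
    _ ≤ _ := measureReal_union_le _ _
    _ ≤ _ := by linarith

end Tail

section Truncation

theorem exists_card_le_sum_compl_le_of_sum_min_le [DecidableEq ι] {b : ι → ℝ}
    (hb : ∀ i, 0 ≤ b i) {t : ℝ} (ht : 0 < t) {k : ℕ} (hk : ∑ i, min (b i / t) 1 ≤ k) :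
    ∃ J : Finset ι, J.card ≤ k ∧ ∑ i ∈ Jᶜ, b i ≤ t * k := by
  have hmin0 (i : ι) : 0 ≤ min (b i / t) 1 := le_min (div_nonneg (hb i) ht.le) zero_le_one
  refine ⟨({i | t < b i} : Finset ι), ?_, ?_⟩
  · suffices h : (({i | t < b i} : Finset ι).card : ℝ) ≤ k from mod_cast h
    calc (({i | t < b i} : Finset ι).card : ℝ) = ∑ i with t < b i, (1 : ℝ) := by simp
      _ ≤ ∑ i with t < b i, min (b i / t) 1 := Finset.sum_le_sum fun i hi =>
          le_min ((one_le_div ht).2 (Finset.mem_filter.1 hi).2.le) le_rfl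
      _ ≤ ∑ i, min (b i / t) 1 :=
          Finset.sum_le_sum_of_subset_of_nonneg (Finset.subset_univ _) fun i _ _ => hmin0 i
      _ ≤ k := hk
  · have hkept {i : ι} (hi : i ∈ ({i | t < b i} : Finset ι)ᶜ) : b i = t * min (b i / t) 1 := by
      have hle : b i ≤ t := by simpa using hi
      rw [min_eq_left ((div_le_one ht).2 hle), mul_div_cancel₀ _ ht.ne']
    rw [Finset.sum_congr rfl fun i hi => hkept hi, ← Finset.mul_sum]
    gcongr
    exact (Finset.sum_le_sum_of_subset_of_nonneg (Finset.subset_univ _)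
      fun i _ _ => hmin0 i).trans hk

/-- Truncating every variable at `4 * M / k` makes the sum concentrate, and dropping the summands
above the truncation level removes at most `k` of them. -/
theorem measureReal_forall_lt_sum_compl_le (hindep : iIndepFun X P) (hmeas : ∀ i, Measurable (X i))
    (hX : ∀ i ω, 0 ≤ X i ω) (h_int : ∀ i, Integrable (X i) P) {M : ℝ} (hM : 0 < M)
    (hsum : ∑ i, P[X i] ≤ M) [DecidableEq ι] {k : ℕ} (hk : 0 < k) :
    P.real {ω | ∀ J : Finset ι, J.card ≤ k → 4 * M < ∑ i ∈ Jᶜ, X i ω} ≤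
      Real.exp (-(k / 2 : ℝ)) := by
  have := hindep.isProbabilityMeasure
  have hk0 : (0 : ℝ) < k := mod_cast hk
  set t : ℝ := 4 * M / k with ht
  have ht0 : 0 < t := by positivity
  let Y (i : ι) (ω : Ω) : ℝ := min (X i ω / t) 1
  have htrunc : Measurable fun x : ℝ => min (x / t) 1 := by fun_prop
  have hYmeas (i : ι) : Measurable (Y i) := htrunc.comp (hmeas i)
  have hYIcc (i : ι) (ω : Ω) : Y i ω ∈ Set.Icc 0 1 :=
    ⟨le_min (div_nonneg (hX i ω) ht0.le) zero_le_one, min_le_right _ _⟩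
  have hmean : ∑ i, P[Y i] ≤ (k / 4 : ℝ) := calc
    ∑ i, P[Y i] ≤ ∑ i, P[X i] / t := Finset.sum_le_sum fun i _ => by
      rw [← integral_div]
      exact integral_mono (.of_mem_Icc 0 1 (hYmeas i).aemeasurable (.of_forall (hYIcc i)))
        ((h_int i).div_const t) fun ω => min_le_left _ _
    _ ≤ M / t := by rw [← Finset.sum_div]; gcongr
    _ = k / 4 := by rw [ht]; field_simp
  calc _ ≤ P.real {ω | (k : ℝ) ≤ ∑ i, Y i ω} := measureReal_mono fun ω hω => by
        by_contra hlt
        obtain ⟨J, hJ, hle⟩ :=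
          exists_card_le_sum_compl_le_of_sum_min_le (fun i => hX i ω) ht0 (not_le.1 hlt).le
        exact (hω J hJ).not_ge (hle.trans_eq (by rw [ht]; field_simp))
    _ ≤ Real.exp ((Real.exp 1 - 1) * ∑ i, P[Y i] - 1 * k) :=
        measureReal_le_sum_le_exp (hindep.comp (fun _ => _) fun _ => htrunc) hYmeas
          (fun i => .of_forall (hYIcc i)) zero_le_one _
    _ ≤ _ := Real.exp_le_exp.2 (by nlinarith [Real.exp_one_lt_three, Real.exp_one_gt_two])

end Truncation

end Chernoff

/-! ### Sampling -/

section Sampling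

open ProbabilityTheory

section UniformOn

variable {α : Type*} [Fintype α] [MeasurableSpace α] [MeasurableSingletonClass α]

theorem integral_uniformOn_univ (f : α → ℝ) :
    ∫ x, f x ∂uniformOn Set.univ = (∑ x, f x) / Fintype.card α := by
  rw [integral_fintype .of_finite, Finset.sum_div]
  refine Finset.sum_congr rfl fun x _ => ?_
  rw [measureReal_def, uniformOn_univ, Measure.count_singleton, ENNReal.toReal_div,
    ENNReal.toReal_one, ENNReal.toReal_natCast, smul_eq_mul, one_div_mul_eq_div]

end UniformOn

/-- The law of a family of independent uniform samples `(u, a)`: a vertex and a budget level. -/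
noncomputable def sampleLaw (n Q : ℕ) (ι : Type*) [Fintype ι] : Measure (ι → Fin n × Fin Q) :=
  Measure.pi fun _ => uniformOn Set.univ

variable {n w Q r : ℕ} {G : WeightedGraph n w}

instance [NeZero n] [NeZero Q] (ι : Type*) [Fintype ι] : IsProbabilityMeasure (sampleLaw n Q ι) :=
  inferInstanceAs (IsProbabilityMeasure (Measure.pi _))

theorem iIndepFun_sampleLaw [NeZero n] [NeZero Q] {ι : Type*} [Fintype ι]
    (f : ι → Fin n × Fin Q → ℝ) : iIndepFun (fun j s => f j (s j)) (sampleLaw n Q ι) :=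
  iIndepFun_pi fun _ => Measurable.of_discrete.aemeasurable

theorem integral_sampleLaw [NeZero n] [NeZero Q] {ι : Type*} [Fintype ι] (j : ι)
    (f : Fin n × Fin Q → ℝ) : ∫ s, f (s j) ∂sampleLaw n Q ι = ∫ x, f x ∂uniformOn Set.univ :=
  integral_comp_eval Measurable.of_discrete.aestronglyMeasurable

namespace WeightedGraph.AdjList

variable (L : G.AdjList) (i : ℕ) (u : Fin n)

theorem degree_add_one_le_componentVolume : L.degree u + 1 ≤ L.componentVolume i u := by
  classical
  exact Finset.single_le_sum (f := fun v => L.degree v + 1) (fun _ _ => Nat.zero_le _)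
    (Finset.mem_filter.2 ⟨Finset.mem_univ u, .refl u⟩)

theorem componentVolume_pos : 0 < L.componentVolume i u :=
  (Nat.succ_pos _).trans_le (L.degree_add_one_le_componentVolume i u)

theorem volume_univ : (L.volume Finset.univ : ℝ) = n * (G.avgDegree + 1) := by
  classical
  have hdeg (v : Fin n) : L.degree v = G.graph.degree v := by
    rw [degree, ← List.toFinset_card_of_nodup (L.nodup v),
      ← SimpleGraph.card_neighborFinset_eq_degree]
    congr 1
    ext u
    simp [L.mem_nbrs]
  have hsum := G.graph.sum_degrees_eq_twice_card_edges
  rw [SimpleGraph.edgeFinset, ← Set.ncard_eq_toFinset_card'] at hsum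
  obtain rfl | hn := eq_or_ne n 0
  · simp [volume]
  · rw [volume, Finset.sum_add_distrib, Finset.sum_congr rfl fun v _ => hdeg v, hsum, avgDegree]
    simp only [Nat.cast_add, Nat.cast_mul, Nat.cast_ofNat, Finset.sum_const, Finset.card_univ,
      Fintype.card_fin, smul_eq_mul, mul_one]
    field_simp

theorem sum_degree_div_componentVolume :
    ∑ u, ((L.degree u + 1 : ℕ) : ℝ) / L.componentVolume i u = G.numComponents i := by
  classical
  have hone (C : (G.threshold i).ConnectedComponent) :
      ∑ u with (G.threshold i).connectedComponentMk u = C,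
        ((L.degree u + 1 : ℕ) : ℝ) / L.componentVolume i u = 1 := by
    have hvol {u : Fin n} (hu : (G.threshold i).connectedComponentMk u = C) :
        L.componentVolume i u = L.volume {v | (G.threshold i).connectedComponentMk v = C} := by
      rw [componentVolume]
      refine congrArg L.volume (Finset.filter_congr fun v _ => ?_)
      rw [← hu, SimpleGraph.ConnectedComponent.eq, SimpleGraph.reachable_comm]
    rw [Finset.sum_congr rfl fun u hu => by rw [hvol (Finset.mem_filter.1 hu).2],
      ← Finset.sum_div, ← Nat.cast_sum]
    obtain ⟨x, hx⟩ := C.exists_rep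
    refine div_self (Nat.cast_ne_zero.2 ?_)
    exact (hvol hx ▸ L.componentVolume_pos i x).ne'
  rw [← Finset.sum_fiberwise Finset.univ (fun u => (G.threshold i).connectedComponentMk u),
    Finset.sum_congr rfl fun C _ => hone C]
  simp [numComponents]

theorem isHit_iff {u : Fin n} {a : Fin Q} :
    L.IsHit i (u, a) ↔ (a : ℕ) < Q * (L.degree u + 1) / L.componentVolume i u := by
  rw [IsHit, sampleBudget, Nat.le_div_iff_mul_le (Nat.succ_pos _), Nat.lt_iff_add_one_le,
    Nat.le_div_iff_mul_le (L.componentVolume_pos i u), mul_comm]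

open Classical in
theorem card_isHit :
    ({a | L.IsHit i (u, a)} : Finset (Fin Q)).card =
      Q * (L.degree u + 1) / L.componentVolume i u := by
  have hle : Q * (L.degree u + 1) / L.componentVolume i u ≤ Q :=
    Nat.div_le_of_le_mul
      ((Nat.mul_le_mul_left Q (L.degree_add_one_le_componentVolume i u)).trans_eq (mul_comm _ _))
  rw [← min_eq_right hle, ← Fin.card_filter_val_lt]
  exact congrArg Finset.card (Finset.filter_congr fun a _ => L.isHit_iff i)

/-- The probability that a uniform sample is a hit at threshold `i`. -/
noncomputable def hitProb (L : G.AdjList) (Q i : ℕ) : ℝ :=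
  (uniformOn Set.univ).real {s : Fin n × Fin Q | L.IsHit i s}

theorem mul_hitProb [NeZero n] [NeZero Q] :
    n * L.hitProb Q i =
      ∑ u, ((Q * (L.degree u + 1) / L.componentVolume i u : ℕ) : ℝ) / Q := by
  classical
  have hn : (n : ℝ) ≠ 0 := Nat.cast_ne_zero.2 (NeZero.ne n)
  rw [hitProb, ← integral_indicator_one .of_discrete, integral_uniformOn_univ,
    Fintype.sum_prod_type, ← Finset.sum_div]
  simp only [Set.indicator_apply, Set.mem_ofPred_eq, Pi.one_apply, Finset.sum_boole, card_isHit,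
    Fintype.card_prod, Fintype.card_fin, Nat.cast_mul]
  field_simp

theorem mul_hitProb_le [NeZero n] [NeZero Q] :
    n * L.hitProb Q i ≤ G.numComponents i := by
  rw [mul_hitProb, ← L.sum_degree_div_componentVolume]
  refine Finset.sum_le_sum fun u _ => ?_
  have hQ : (0 : ℝ) < Q := Nat.cast_pos.2 (NeZero.pos Q)
  rw [div_le_iff₀ hQ, div_mul_eq_mul_div, ← Nat.cast_mul, mul_comm _ Q]
  exact Nat.cast_div_le

theorem le_mul_hitProb [NeZero n] [NeZero Q] :
    (G.numComponents i : ℝ) - n / Q ≤ n * L.hitProb Q i := by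
  rw [mul_hitProb, ← L.sum_degree_div_componentVolume,
    show (n : ℝ) / Q = ∑ _u : Fin n, (1 : ℝ) / Q by simp [div_eq_mul_inv], ← Finset.sum_sub_distrib]
  refine Finset.sum_le_sum fun u _ => ?_
  have hQ : (0 : ℝ) < Q := Nat.cast_pos.2 (NeZero.pos Q)
  have hvol : (0 : ℝ) < L.componentVolume i u := Nat.cast_pos.2 (L.componentVolume_pos i u)
  have hlt : Q * (L.degree u + 1) <
      (Q * (L.degree u + 1) / L.componentVolume i u + 1) * L.componentVolume i u :=
    (Nat.lt_div_mul_add (L.componentVolume_pos i u)).trans_eq (by ring)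
  rw [sub_le_iff_le_add, ← add_div, div_le_div_iff₀ hvol hQ, mul_comm _ (Q : ℝ)]
  exact mod_cast hlt.le

theorem integral_sampleBudget_le [NeZero n] [NeZero Q] :
    ∫ s : Fin n × Fin Q, (sampleBudget s (L.degree s.1) : ℝ) ∂uniformOn Set.univ ≤
      (G.avgDegree + 1) * (1 + Real.log Q) := by
  have hn : (0 : ℝ) < n := Nat.cast_pos.2 (NeZero.pos n)
  have hQ : (0 : ℝ) < Q := Nat.cast_pos.2 (NeZero.pos Q)
  have hharmonic : ∑ a : Fin Q, ((a : ℝ) + 1)⁻¹ ≤ 1 + Real.log Q := by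
    rw [Fin.sum_univ_eq_sum_range (fun a => ((a : ℝ) + 1)⁻¹)]
    exact (harmonic_le_one_add_log Q).trans_eq' (by simp [harmonic])
  have hsum : ∑ s : Fin n × Fin Q, (sampleBudget s (L.degree s.1) : ℝ) ≤
      Q * ((n * (G.avgDegree + 1)) * (1 + Real.log Q)) := calc
    _ ≤ ∑ s : Fin n × Fin Q, (Q : ℝ) * (((L.degree s.1 + 1 : ℕ) : ℝ) * ((s.2 : ℝ) + 1)⁻¹) :=
        Finset.sum_le_sum fun s _ => Nat.cast_div_le.trans_eq (by push_cast; ring)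
    _ = Q * ((∑ u, ((L.degree u + 1 : ℕ) : ℝ)) * ∑ a : Fin Q, ((a : ℝ) + 1)⁻¹) := by
        rw [Finset.sum_mul_sum, ← Finset.mul_sum, Fintype.sum_prod_type]
    _ ≤ _ := by
        rw [← Nat.cast_sum, ← L.volume_univ]
        gcongr
        rfl
  rw [integral_uniformOn_univ, Fintype.card_prod, Fintype.card_fin, Fintype.card_fin, Nat.cast_mul,
    div_le_iff₀ (by positivity)]
  exact hsum.trans_eq (by ring)

end WeightedGraph.AdjList

end Sampling

section Estimator

open ProbabilityTheory

theorem abs_mul_sub_le_of_mixed_error {c F n N S k r γ μ : ℝ} (hc : 0 ≤ c) (hcr : c * r = n)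
    (hγ : 0 ≤ γ) (hk : k ≤ γ * r) (hN : N ≤ S) (hS : S ≤ N + k) (hdev : |S - μ| ≤ γ * (r + μ))
    (hnF : n ≤ F) (hup : c * μ ≤ F) (hlow : F - γ * n ≤ c * μ) :
    |c * N - F| ≤ 4 * γ * F := by
  obtain ⟨h1, h2⟩ := abs_le.1 hdev
  have hupper : c * N ≤ c * μ + γ * (n + c * μ) := calc
    c * N ≤ c * (μ + γ * (r + μ)) := by gcongr; linarith
    _ = c * μ + γ * (c * r + c * μ) := by ring
    _ = _ := by rw [hcr]
  have hlower : c * μ - γ * (n + c * μ) - γ * n ≤ c * N := calc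
    c * μ - γ * (n + c * μ) - γ * n = c * (μ - γ * (r + μ) - γ * r) := by rw [← hcr]; ring
    _ ≤ c * N := by gcongr; linarith
  have hγμ := mul_le_mul_of_nonneg_left hup hγ
  have hγn := mul_le_mul_of_nonneg_left hnF hγ
  rw [abs_le]
  constructor <;> linarith

variable {n w r Q : ℕ} [NeZero n] [NeZero Q] {G : WeightedGraph n w} (L : G.AdjList)

theorem WeightedGraph.AdjList.mul_sum_hitProb_mem_Icc (hr : r ≠ 0) {γ : ℝ} (hwQ : w ≤ γ * Q) :
    n / r * ∑ j : Fin w × Fin r, L.hitProb Q j.1 ∈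
      Set.Icc (G.componentSum - γ * n) (G.componentSum : ℝ) := by
  have hQ : (0 : ℝ) < Q := Nat.cast_pos.2 (NeZero.pos Q)
  have hsum : n / r * ∑ j : Fin w × Fin r, L.hitProb Q j.1 =
      ∑ i ∈ Finset.range w, n * L.hitProb Q i := by
    rw [← Finset.mul_sum, ← Fin.sum_univ_eq_sum_range (L.hitProb Q)]
    simp only [Fintype.sum_prod_type, Finset.sum_const, Finset.card_univ, Fintype.card_fin,
      nsmul_eq_mul]
    rw [← Finset.mul_sum]
    field_simp
  rw [hsum, WeightedGraph.componentSum, Nat.cast_sum]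
  refine ⟨?_, Finset.sum_le_sum fun i _ => L.mul_hitProb_le i⟩
  calc ∑ i ∈ Finset.range w, (G.numComponents i : ℝ) - γ * n
      ≤ ∑ i ∈ Finset.range w, ((G.numComponents i : ℝ) - n / Q) := by
        rw [Finset.sum_sub_distrib, Finset.sum_const, Finset.card_range, nsmul_eq_mul]
        refine sub_le_sub_left ?_ _
        rw [mul_div_assoc', div_le_iff₀ hQ]
        nlinarith [n.cast_nonneg (α := ℝ)]
    _ ≤ _ := Finset.sum_le_sum fun i _ => L.le_mul_hitProb i

namespace QueryProg

theorem measureReal_lt_abs_countHits_sub_le (hw : 1 ≤ w) (hr : r ≠ 0) {γ : ℝ} (hγ0 : 0 ≤ γ)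
    (hγ1 : γ ≤ 1) {k : ℕ} (hk : k ≤ γ * r) (hwQ : w ≤ γ * Q) :
    (sampleLaw n Q (Fin w × Fin r)).real
      {s | 4 * γ * G.componentSum <
        |n / r * ((run L (countHits k (fun j => (j.1 : ℕ)) s) : ℕ) : ℝ) - G.componentSum|} ≤
      2 * Real.exp (-(γ ^ 2 * r / 2)) := by
  classical
  have hr0 : (0 : ℝ) < r := Nat.cast_pos.2 (Nat.pos_of_ne_zero hr)
  let X (j : Fin w × Fin r) : Fin n × Fin Q → ℝ := {x | L.IsHit j.1 x}.indicator 1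
  have hdev := measureReal_lt_abs_sum_sub_le (ρ := r) (iIndepFun_sampleLaw X)
    (fun j => Measurable.of_discrete) (fun j => .of_forall fun s =>
      ⟨Set.indicator_nonneg (fun _ _ => zero_le_one) _,
        Set.indicator_le_self' (fun _ _ => zero_le_one) _⟩) hγ0 hγ1
  have h_int (j : Fin w × Fin r) :
      ∫ s, X j (s j) ∂sampleLaw n Q (Fin w × Fin r) = L.hitProb Q j.1 := by
    rw [integral_sampleLaw, integral_indicator_one .of_discrete]
    rfl
  simp only [h_int] at hdev
  obtain ⟨hlow, hup⟩ := L.mul_sum_hitProb_mem_Icc hr hwQ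
  refine (measureReal_mono fun s hs => ?_).trans hdev
  by_contra hgood
  have hcount : ∑ j, X j (s j) = ({j | L.IsHit j.1 (s j)} : Finset (Fin w × Fin r)).card := by
    simp [X, Set.indicator_apply]
  refine not_lt.2 ?_ (Set.mem_ofPred_eq ▸ hs)
  refine abs_mul_sub_le_of_mixed_error (by positivity) (div_mul_cancel₀ _ hr0.ne') hγ0 hk ?_ ?_
    (not_lt.1 hgood) (Nat.cast_le.2 (G.le_componentSum hw)) hup hlow
  · rw [hcount]
    exact mod_cast run_countHits_le L k _ s
  · rw [hcount]
    exact mod_cast card_isHit_le_run_countHits_add L k _ s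

theorem measureReal_lt_cost_countHits_le (hw : w ≠ 0) (hr : r ≠ 0) {k : ℕ} (hk : 0 < k)
    {b : ℝ} (hb : 2 * (w * r) + 4 * (w * r * ((G.avgDegree + 1) * (1 + Real.log Q))) ≤ b) :
    (sampleLaw n Q (Fin w × Fin r)).real
      {s | b < ((countHits k (fun j => (j.1 : ℕ)) s).cost L : ℝ)} ≤ Real.exp (-(k / 2 : ℝ)) := by
  have hpos : (0 : ℝ) < w * r * ((G.avgDegree + 1) * (1 + Real.log Q)) := by
    have : 0 ≤ G.avgDegree := by unfold WeightedGraph.avgDegree; positivity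
    have := Real.log_natCast_nonneg Q
    positivity
  refine (measureReal_mono fun s hs J hJ => ?_).trans
    (measureReal_forall_lt_sum_compl_le (iIndepFun_sampleLaw
      fun _ x => (sampleBudget x (L.degree x.1) : ℝ)) (fun _ => Measurable.of_discrete)
      (fun _ _ => Nat.cast_nonneg _) (fun _ => .of_finite) hpos ?_ hk)
  · have hcost : ((countHits k (fun j => (j.1 : ℕ)) s).cost L : ℝ) ≤
        2 * (w * r) + ∑ j ∈ Jᶜ, (sampleBudget (s j) (L.degree (s j).1) : ℝ) :=
      mod_cast (cost_countHits_le L k _ s hJ).trans_eq (by simp)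
    linarith [Set.mem_ofPred_eq ▸ hs]
  · simp only [integral_sampleLaw _ fun x => (sampleBudget x (L.degree x.1) : ℝ)]
    rw [Finset.sum_const, Finset.card_univ, Fintype.card_prod, Fintype.card_fin, Fintype.card_fin,
      nsmul_eq_mul, Nat.cast_mul]
    gcongr
    exact L.integral_sampleBudget_le

end QueryProg

end Estimator

/-! ### Laplace noise -/

section Laplace

open scoped NNReal

theorem integral_exp_neg_abs_div_two : ∫ u : ℝ, Real.exp (-|u|) / 2 = 1 := by
  rw [integral_comp_abs (f := fun u => Real.exp (-u) / 2), integral_div,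
    integral_exp_neg_Ioi_zero, mul_one_div_cancel two_ne_zero]

theorem integrable_exp_neg_abs_div_two : Integrable fun u : ℝ => Real.exp (-|u|) / 2 :=
  integrable_of_integral_eq_one integral_exp_neg_abs_div_two

/-- The Laplace distribution centered at `0` with scale `1`. -/
noncomputable def stdLaplace : Measure ℝ :=
  volume.withDensity fun u => ENNReal.ofReal (Real.exp (-|u|) / 2)

instance : IsProbabilityMeasure stdLaplace where
  measure_univ := by
    rw [stdLaplace, withDensity_apply _ .univ, Measure.restrict_univ,
      ← ofReal_integral_eq_lintegral_ofReal integrable_exp_neg_abs_div_two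
        (.of_forall fun u => by positivity), integral_exp_neg_abs_div_two, ENNReal.ofReal_one]

theorem measureReal_stdLaplace_lt_abs {s : ℝ} (hs : 0 ≤ s) :
    stdLaplace.real {u | s < |u|} = Real.exp (-s) := by
  have hmeas : MeasurableSet {u : ℝ | s < |u|} := measurableSet_lt measurable_const (by fun_prop)
  have heven : {u : ℝ | s < |u|}.indicator (fun u => Real.exp (-|u|) / 2) =
      fun u => (Set.Ioi s).indicator (fun v => Real.exp (-v) / 2) |u| := by
    funext u
    simp [Set.indicator_apply]
  rw [measureReal_def, stdLaplace, withDensity_apply _ hmeas,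
    ← integral_eq_lintegral_of_nonneg_ae (.of_forall fun u => by positivity) (by fun_prop),
    ← integral_indicator hmeas, heven, integral_comp_abs, setIntegral_indicator measurableSet_Ioi,
    Set.inter_eq_right.2 (Set.Ioi_subset_Ioi hs), integral_div, integral_exp_neg_Ioi]
  ring

theorem map_add_stdLaplace_le (t : ℝ) :
    stdLaplace.map (t + ·) ≤ ENNReal.ofReal (Real.exp |t|) • stdLaplace := by
  refine Measure.le_iff.2 fun S hS => ?_
  rw [Measure.map_apply (by fun_prop) hS, Measure.smul_apply, smul_eq_mul, stdLaplace,
    withDensity_apply _ hS, withDensity_apply _ (hS.preimage (by fun_prop)),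
    ← lintegral_const_mul _ (by fun_prop), ← lintegral_indicator hS,
    ← lintegral_indicator (hS.preimage (by fun_prop)),
    ← lintegral_add_left_eq_self (S.indicator _) t]
  refine lintegral_mono fun u => ?_
  by_cases hu : t + u ∈ S
  · rw [Set.indicator_of_mem hu, Set.indicator_of_mem (Set.mem_preimage.2 hu),
      ← ENNReal.ofReal_mul (Real.exp_nonneg _), mul_div_assoc', ← Real.exp_add]
    gcongr
    linarith [abs_add_le t u]
  · rw [Set.indicator_of_notMem hu, Set.indicator_of_notMem (mt Set.mem_preimage.1 hu)]

/-- The Laplace distribution centered at `x` with scale `1 / ε`. -/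
noncomputable def laplace (ε x : ℝ) : Measure ℝ :=
  stdLaplace.map fun u => x + u / ε

instance (ε x : ℝ) : IsProbabilityMeasure (laplace ε x) :=
  Measure.isProbabilityMeasure_map (by fun_prop)

variable {ε : ℝ}

theorem measureReal_laplace_lt_abs_sub (hε : 0 < ε) (x : ℝ) {s : ℝ} (hs : 0 ≤ s) :
    (laplace ε x).real {z | s < |z - x|} = Real.exp (-(ε * s)) := by
  rw [laplace, map_measureReal_apply (by fun_prop)
    (measurableSet_lt measurable_const (by fun_prop)), ← measureReal_stdLaplace_lt_abs
    (mul_nonneg hε.le hs)]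
  congr 1
  ext u
  simp [abs_div, abs_of_pos hε, lt_div_iff₀ hε, mul_comm]

theorem laplace_le_smul_laplace (hε : 0 < ε) {x y : ℝ} (hxy : |x - y| ≤ 1) :
    laplace ε x ≤ ENNReal.ofReal (Real.exp ε) • laplace ε y := by
  have hshift : laplace ε x = (stdLaplace.map (ε * (x - y) + ·)).map fun u => y + u / ε := by
    rw [laplace, Measure.map_map (by fun_prop) (by fun_prop)]
    congr 1
    funext u
    simp only [Function.comp_apply]
    field_simp
    ring
  rw [hshift, laplace, ← Measure.map_smul]
  refine Measure.map_mono ((map_add_stdLaplace_le _).trans ?_) (by fun_prop)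
  gcongr
  rw [abs_mul, abs_of_pos hε]
  exact mul_le_of_le_one_right hε.le hxy

theorem measureReal_laplace_le_mul (hε : 0 < ε) {x y : ℝ} (hxy : |x - y| ≤ 1) (S : Set ℝ) :
    (laplace ε x).real S ≤ Real.exp ε * (laplace ε y).real S := by
  have h := Measure.le_iff'.1 (laplace_le_smul_laplace hε hxy) S
  rw [Measure.smul_apply, smul_eq_mul] at h
  refine (ENNReal.toReal_mono (by finiteness) h).trans_eq ?_
  rw [ENNReal.toReal_mul, ENNReal.toReal_ofReal (Real.exp_nonneg _), measureReal_def]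

/-- The equal mixture of the Laplace distributions centered at `0, …, n`. -/
noncomputable def laplaceGrid (ε : ℝ) (n : ℕ) : Measure ℝ :=
  (n + 1 : ℝ≥0)⁻¹ • ∑ j ∈ Finset.range (n + 1), laplace ε j

instance (ε : ℝ) (n : ℕ) : IsProbabilityMeasure (laplaceGrid ε n) where
  measure_univ := by
    rw [laplaceGrid, Measure.smul_apply, Measure.finsetSum_apply]
    simp only [measure_univ, Finset.sum_const, Finset.card_range, nsmul_eq_mul, mul_one]
    rw [ENNReal.smul_def, smul_eq_mul]
    exact_mod_cast inv_mul_cancel₀ (NeZero.ne ((n + 1 : ℕ) : ℝ≥0))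

theorem measureReal_laplaceGrid (ε : ℝ) (n : ℕ) (S : Set ℝ) :
    (laplaceGrid ε n).real S = (∑ j ∈ Finset.range (n + 1), (laplace ε j).real S) / (n + 1) := by
  rw [laplaceGrid, measureReal_nnreal_smul_apply, measureReal_def, Measure.finsetSum_apply,
    ENNReal.toReal_sum fun _ _ => by finiteness, div_eq_inv_mul]
  norm_cast

theorem measureReal_laplace_le_mul_laplaceGrid (hε : 0 < ε) {n : ℕ} {x : ℝ}
    (hx : x ∈ Set.Icc 0 (n : ℝ)) (S : Set ℝ) :
    (laplace ε x).real S ≤ Real.exp ε * (n + 1) * (laplaceGrid ε n).real S := by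
  have hfloor : |x - (⌊x⌋₊ : ℝ)| ≤ 1 := by
    rw [abs_of_nonneg (sub_nonneg.2 (Nat.floor_le hx.1))]
    linarith [Nat.lt_floor_add_one x]
  calc (laplace ε x).real S
      ≤ Real.exp ε * (laplace ε ⌊x⌋₊).real S := measureReal_laplace_le_mul hε hfloor S
    _ ≤ Real.exp ε * ∑ j ∈ Finset.range (n + 1), (laplace ε j).real S := by
        gcongr
        exact Finset.single_le_sum (f := fun j : ℕ => (laplace ε j).real S)
          (fun _ _ => measureReal_nonneg)
          (Finset.mem_range.2 (Nat.lt_succ_of_le (Nat.floor_le_of_le hx.2)))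
    _ = _ := by
        rw [measureReal_laplaceGrid]
        field_simp

end Laplace

section RobustLaplace

open scoped NNReal

variable {Ω : Type*} [MeasurableSpace Ω] [DiscreteMeasurableSpace Ω] [Finite Ω] {P : Measure Ω}
  [IsProbabilityMeasure P]

/-- Laplace noise centered at `x` with scale `1 / ε`, contaminated with weight `1 / (E + 1)` by the
Laplace grid. On centers in `[0, n]`, the contamination hides the failure of a sensitivity bound
with a small probability. -/
noncomputable def robustLaplace (ε : ℝ) (n : ℕ) (E : ℝ≥0) (x : ℝ) : Measure ℝ :=
  (E + 1)⁻¹ • (E • laplace ε x + laplaceGrid ε n)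

instance (ε : ℝ) (n : ℕ) (E : ℝ≥0) (x : ℝ) : IsProbabilityMeasure (robustLaplace ε n E x) where
  measure_univ := by
    rw [robustLaplace, Measure.smul_apply, Measure.add_apply, Measure.smul_apply, measure_univ,
      measure_univ, ENNReal.smul_def, ENNReal.smul_def, smul_eq_mul, smul_eq_mul, mul_one]
    exact_mod_cast inv_mul_cancel₀ (show E + 1 ≠ 0 by positivity)

theorem measureReal_robustLaplace (ε : ℝ) (n : ℕ) (E : ℝ≥0) (x : ℝ) (S : Set ℝ) :
    (robustLaplace ε n E x).real S =
      (E * (laplace ε x).real S + (laplaceGrid ε n).real S) / (E + 1) := by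
  rw [robustLaplace, measureReal_nnreal_smul_apply, measureReal_add_apply,
    measureReal_nnreal_smul_apply, div_eq_inv_mul]
  norm_cast

theorem integral_robustLaplace (ε : ℝ) (n : ℕ) (E : ℝ≥0) (f : Ω → ℝ) (S : Set ℝ) :
    ∫ ω, (robustLaplace ε n E (f ω)).real S ∂P =
      (E * ∫ ω, (laplace ε (f ω)).real S ∂P + (laplaceGrid ε n).real S) / (E + 1) := by
  simp only [measureReal_robustLaplace]
  rw [integral_div, integral_add .of_finite .of_finite, integral_const_mul]
  simp

theorem integral_le_integral_add_mul_measureReal {u v : Ω → ℝ} {M : ℝ} {bad : Set Ω}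
    (hv : ∀ ω, 0 ≤ v ω) (hgood : ∀ ω ∉ bad, u ω ≤ v ω) (hbad : ∀ ω ∈ bad, u ω ≤ M) :
    ∫ ω, u ω ∂P ≤ ∫ ω, v ω ∂P + M * P.real bad := by
  calc ∫ ω, u ω ∂P ≤ ∫ ω, (v ω + bad.indicator (fun _ => M) ω) ∂P := by
        refine integral_mono .of_finite .of_finite fun ω => ?_
        by_cases hω : ω ∈ bad
        · simpa [hω] using (hbad ω hω).trans (le_add_of_nonneg_left (hv ω))
        · simpa [hω] using hgood ω hω
    _ = _ := by
        rw [integral_add .of_finite .of_finite, integral_indicator_const M .of_discrete,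
          smul_eq_mul, mul_comm]

theorem integral_robustLaplace_le_exp_mul {ε : ℝ} (hε : 0 < ε) {n : ℕ} {E : ℝ≥0} {f g : Ω → ℝ}
    (hf : ∀ ω, f ω ∈ Set.Icc 0 (n : ℝ)) {bad : Set Ω} (hfg : ∀ ω ∉ bad, |f ω - g ω| ≤ 1)
    (hbad : E * P.real bad * (Real.exp ε * (n + 1)) ≤ Real.exp ε - 1) (S : Set ℝ) :
    ∫ ω, (robustLaplace ε n E (f ω)).real S ∂P ≤
      Real.exp ε * ∫ ω, (robustLaplace ε n E (g ω)).real S ∂P := by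
  have hcouple := integral_le_integral_add_mul_measureReal (P := P)
    (fun ω => mul_nonneg (Real.exp_nonneg ε) measureReal_nonneg)
    (fun ω hω => measureReal_laplace_le_mul hε (hfg ω hω) S)
    (fun ω _ => measureReal_laplace_le_mul_laplaceGrid hε (hf ω) S)
  rw [integral_const_mul] at hcouple
  rw [integral_robustLaplace, integral_robustLaplace, mul_div_assoc']
  gcongr
  set ν := (laplaceGrid ε n).real S
  calc E * ∫ ω, (laplace ε (f ω)).real S ∂P + ν
      ≤ E * (Real.exp ε * ∫ ω, (laplace ε (g ω)).real S ∂P +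
          Real.exp ε * (n + 1) * ν * P.real bad) + ν := by gcongr
    _ = Real.exp ε * (E * ∫ ω, (laplace ε (g ω)).real S ∂P) +
          (E * P.real bad * (Real.exp ε * (n + 1)) * ν + ν) := by ring
    _ ≤ Real.exp ε * (E * ∫ ω, (laplace ε (g ω)).real S ∂P) + ((Real.exp ε - 1) * ν + ν) := by
        gcongr
    _ = _ := by ring

theorem le_integral_robustLaplace {ε s : ℝ} (hε : 0 < ε) (hs : 0 ≤ s) (n : ℕ) (E : ℝ≥0)
    {f : Ω → ℝ} {bad : Set Ω} {S : Set ℝ} (hS : MeasurableSet S)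
    (hgood : ∀ ω ∉ bad, ∀ z, |z - f ω| ≤ s → z ∈ S) :
    1 - 1 / (E + 1) - Real.exp (-(ε * s)) - P.real bad ≤
      ∫ ω, (robustLaplace ε n E (f ω)).real S ∂P := by
  have hmiss : ∫ ω, (laplace ε (f ω)).real Sᶜ ∂P ≤ Real.exp (-(ε * s)) + P.real bad := by
    have h := integral_le_integral_add_mul_measureReal (P := P)
      (u := fun ω => (laplace ε (f ω)).real Sᶜ) (v := fun _ => Real.exp (-(ε * s))) (bad := bad)
      (fun _ => Real.exp_nonneg _) (fun ω hω => ?_) (fun ω _ => measureReal_le_one)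
    · simpa using h
    · rw [← measureReal_laplace_lt_abs_sub hε (f ω) hs]
      exact measureReal_mono fun z hz => not_le.1 fun hle => hz (hgood ω hω z hle)
  have hcompl : ∫ ω, (laplace ε (f ω)).real S ∂P = 1 - ∫ ω, (laplace ε (f ω)).real Sᶜ ∂P := by
    simp only [probReal_compl_eq_one_sub hS]
    rw [integral_sub .of_finite .of_finite]
    simp
  rw [integral_robustLaplace, hcompl]
  set μ := Real.exp (-(ε * s)) + P.real bad
  have : (0 : ℝ) < E + 1 := by positivity
  have hμ : 0 ≤ μ := by positivity
  calc 1 - 1 / (E + 1) - Real.exp (-(ε * s)) - P.real bad = (E - (E + 1) * μ) / (E + 1) := by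
        simp only [μ]
        field_simp
        ring
    _ ≤ _ := by
        gcongr
        nlinarith [measureReal_nonneg (μ := laplaceGrid ε n) (s := S),
          mul_le_mul_of_nonneg_left hmiss E.coe_nonneg]

end RobustLaplace

section LogScale

/-- A logarithmic scale on which raising `x` to `(1 + O(β)) * x + w` costs at most a constant. -/
noncomputable def logScale (β w x : ℝ) : ℝ := Real.log (1 + β * x / w) / β

/-- The inverse of `logScale`. -/
noncomputable def expScale (β w z : ℝ) : ℝ := w / β * (Real.exp (β * z) - 1)

variable {β w x : ℝ}

theorem exp_mul_logScale (hβ : 0 < β) (hw : 0 < w) (hx : 0 ≤ x) :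
    Real.exp (β * logScale β w x) = 1 + β * x / w := by
  rw [logScale, mul_div_cancel₀ _ hβ.ne', Real.exp_log (by positivity)]

theorem logScale_mem_Icc (hβ : 0 < β) (hw : 0 < w) (hx : 0 ≤ x) :
    logScale β w x ∈ Set.Icc 0 (x / w) := by
  have hpos : 0 ≤ β * x / w := by positivity
  refine ⟨div_nonneg (Real.log_nonneg (by linarith)) hβ.le, ?_⟩
  rw [logScale, div_le_iff₀ hβ]
  calc Real.log (1 + β * x / w) ≤ 1 + β * x / w - 1 := Real.log_le_sub_one_of_pos (by linarith)
    _ = x / w * β := by ring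

theorem add_mul_le_exp_mul_add_mul {x' F F' : ℝ} (hβ0 : 0 ≤ β) (hβ1 : β ≤ 1) (hw : 0 ≤ w)
    (hF' : 0 ≤ F') (hFF' : F ≤ F' + w) (hx : x ≤ (1 + β / 4) * F)
    (hx' : (1 - β / 4) * F' ≤ x') :
    w + β * x ≤ Real.exp β * (w + β * x') := by
  have hslack : 0 ≤ β ^ 2 / 4 * w + β * F' * (β / 2 + β ^ 2 / 4 * (1 - β / 2)) := by
    have : 0 ≤ 1 - β / 2 := by linarith
    positivity
  calc w + β * x ≤ w + β * ((1 + β / 4) * (F' + w)) := by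
        gcongr
        exact hx.trans (by gcongr)
    _ ≤ (1 + β + β ^ 2 / 2) * (w + β * ((1 - β / 4) * F')) := by linarith
    _ ≤ Real.exp β * (w + β * x') := by
        have : 0 ≤ 1 - β / 4 := by linarith
        gcongr
        exact Real.quadratic_le_exp_of_nonneg hβ0

theorem logScale_le_logScale_add_one (hβ0 : 0 < β) (hβ1 : β ≤ 1) (hw : 0 < w) {x' F F' : ℝ}
    (hx0 : 0 ≤ x) (hx'0 : 0 ≤ x') (hF' : 0 ≤ F') (hFF' : F ≤ F' + w)
    (hx : |x - F| ≤ β / 4 * F) (hx' : |x' - F'| ≤ β / 4 * F') :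
    logScale β w x ≤ logScale β w x' + 1 := by
  have hratio := add_mul_le_exp_mul_add_mul (x := x) (x' := x') hβ0.le hβ1 hw.le hF' hFF'
    (by linarith [(abs_le.1 hx).2]) (by linarith [(abs_le.1 hx').1])
  refine le_of_mul_le_mul_left (Real.exp_le_exp.1 ?_) hβ0
  calc Real.exp (β * logScale β w x) = (w + β * x) / w := by
        rw [exp_mul_logScale hβ0 hw hx0]
        field_simp
    _ ≤ Real.exp β * (w + β * x') / w := by gcongr
    _ = Real.exp (β * (logScale β w x' + 1)) := by
        rw [mul_add β, mul_one, Real.exp_add, exp_mul_logScale hβ0 hw hx'0]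
        field_simp

theorem abs_exp_sub_one_le_mul {u t : ℝ} (hu : |u| ≤ t) (ht : t ≤ 1 / 3) :
    |Real.exp u - 1| ≤ 4 / 3 * t := by
  have hquad := abs_le.1 (Real.abs_exp_sub_one_sub_id_le (hu.trans (by linarith)))
  have hsq : u ^ 2 ≤ 1 / 3 * t := by
    rw [← sq_abs]
    nlinarith [abs_nonneg u]
  obtain ⟨h1, h2⟩ := abs_le.1 hu
  rw [abs_le]
  constructor <;> linarith

theorem abs_expScale_sub_le (hβ : 0 < β) (hw : 0 < w) (hx : 0 ≤ x) {z s : ℝ}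
    (hz : |z - logScale β w x| ≤ s) (hs : β * s ≤ 1 / 3) :
    |expScale β w z - x| ≤ 4 / 3 * (s * (w + β * x)) := by
  set u := β * (z - logScale β w x) with hu
  have hus : |u| ≤ β * s := by
    rw [hu, abs_mul, abs_of_pos hβ]
    gcongr
  have hexp : Real.exp (β * z) = (1 + β * x / w) * Real.exp u := by
    rw [← exp_mul_logScale hβ hw hx, ← Real.exp_add, hu]
    ring_nf
  calc |expScale β w z - x| = |(w / β + x) * (Real.exp u - 1)| := by
        rw [expScale, hexp]
        congr 1
        field_simp
        ring
    _ = (w / β + x) * |Real.exp u - 1| := by rw [abs_mul, abs_of_nonneg (by positivity)]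
    _ ≤ (w / β + x) * (4 / 3 * (β * s)) := by
        gcongr
        exact abs_exp_sub_one_le_mul hus hs
    _ = _ := by field_simp

theorem abs_expScale_sub_sub_le {α z s M : ℝ} (hβ : 0 < β) (hw : 0 < w) (hα : α ≤ 1)
    (hβα : β ≤ α / 4) (hs : 0 ≤ s) (hsα : β * s ≤ α / 8) (hwM : w ≤ M) (hx0 : 0 ≤ x)
    (hx : |x - (M + w)| ≤ β / 4 * (M + w)) (hz : |z - logScale β w x| ≤ s) :
    |expScale β w z - w - M| ≤ α * M + 4 / 3 * (w * s) := by
  have : 0 ≤ M := hw.le.trans hwM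
  have hscale := abs_expScale_sub_le hβ hw hx0 hz (by linarith)
  have hrel : |x - (M + w)| ≤ α / 16 * (2 * M) := by
    exact hx.trans (mul_le_mul (by linarith) (by linarith) (by linarith) (by linarith))
  have hx3 : x ≤ 3 * M := by nlinarith [(abs_le.1 hrel).2]
  calc |expScale β w z - w - M| = |(expScale β w z - x) + (x - (M + w))| := by ring_nf
    _ ≤ 4 / 3 * (s * (w + β * x)) + α / 16 * (2 * M) := (abs_add_le _ _).trans (by gcongr)
    _ = 4 / 3 * (w * s) + (4 / 3 * (β * s * x) + α / 16 * (2 * M)) := by ring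
    _ ≤ 4 / 3 * (w * s) + (4 / 3 * (α / 8 * (3 * M)) + α / 16 * (2 * M)) := by
        have : 0 ≤ β * s := by positivity
        gcongr
        linarith
    _ ≤ _ := by nlinarith

end LogScale

/-! ### The private estimator -/

section Mechanism

open scoped NNReal

/-- A noisy version of `y`: the noise is added on the logarithmic scale, and `w` is subtracted from
the result. -/
noncomputable def noisyRelease (β w ε : ℝ) (n : ℕ) (E : ℝ≥0) (y : ℝ) : Measure ℝ :=
  (robustLaplace ε n E (logScale β w y)).map fun z => expScale β w z - w

theorem measurable_expScale_sub (β w : ℝ) : Measurable fun z => expScale β w z - w := by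
  unfold expScale
  fun_prop

instance (β w ε : ℝ) (n : ℕ) (E : ℝ≥0) (y : ℝ) : IsProbabilityMeasure (noisyRelease β w ε n E y) :=
  Measure.isProbabilityMeasure_map (measurable_expScale_sub β w).aemeasurable

theorem measureReal_noisyRelease (β w ε : ℝ) (n : ℕ) (E : ℝ≥0) (y : ℝ) {S : Set ℝ}
    (hS : MeasurableSet S) :
    (noisyRelease β w ε n E y).real S =
      (robustLaplace ε n E (logScale β w y)).real ((fun z => expScale β w z - w) ⁻¹' S) :=
  map_measureReal_apply (measurable_expScale_sub β w) hS

variable {n w r : ℕ} {G H : WeightedGraph n w} {γ : ℝ}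

/-- Samples for the estimation of `componentSum`: for each threshold and each of `r` repetitions, a
vertex and a level at most `⌊w / γ⌋`. -/
abbrev Samples (n w r : ℕ) (γ : ℝ) : Type := Fin w × Fin r → Fin n × Fin (⌊w / γ⌋₊ + 1)

/-- The program counting the hits among the samples, up to a proportion `γ` of discarded ones. -/
noncomputable def sampleHits (s : Samples n w r γ) : QueryProg n ℕ :=
  QueryProg.countHits ⌊γ * r⌋₊ (fun j => (j.1 : ℕ)) s

/-- The private estimator of the weight of a minimum spanning tree. -/
noncomputable def noisyMST (n w r : ℕ) [NeZero n] (γ ε : ℝ) (E : ℝ≥0) : QueryAlgorithm n w :=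
  .ofProg w (sampleLaw n (⌊w / γ⌋₊ + 1) (Fin w × Fin r))
    (fun s : Samples n w r γ => sampleHits s)
    (fun x => noisyRelease (16 * γ) w ε n E (n / r * x))

namespace WeightedGraph.AdjList

/-- The estimate of `componentSum` obtained from the number of hits. -/
noncomputable def componentEstimate (L : G.AdjList) (s : Samples n w r γ) : ℝ :=
  n / r * ((sampleHits s).run L : ℕ)

/-- The samples for which the estimate of `componentSum` has a relative error above `4 * γ`. -/
def badSamples (L : G.AdjList) (r : ℕ) (γ : ℝ) : Set (Samples n w r γ) :=
  {s | 4 * γ * G.componentSum < |L.componentEstimate s - G.componentSum|}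

variable (L : G.AdjList) (L' : H.AdjList)

theorem componentEstimate_nonneg (s : Samples n w r γ) : 0 ≤ L.componentEstimate s := by
  unfold componentEstimate
  positivity

theorem componentEstimate_le (s : Samples n w r γ) : L.componentEstimate s ≤ n * w := by
  have hhits : (sampleHits s).run L ≤ w * r := by
    classical
    exact (QueryProg.run_countHits_le L _ _ s).trans ((Finset.card_le_univ _).trans_eq (by simp))
  calc L.componentEstimate s ≤ n / r * (w * r : ℕ) := by
        unfold componentEstimate
        gcongr
    _ = n * w * (r / r) := by
        push_cast
        ring
    _ ≤ n * w := mul_le_of_le_one_right (by positivity) (div_self_le_one _)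

theorem logScale_componentEstimate_mem_Icc (hγ : 0 < γ) (hw : 1 ≤ w) (s : Samples n w r γ) :
    logScale (16 * γ) w (L.componentEstimate s) ∈ Set.Icc 0 (n : ℝ) := by
  have hw0 : (0 : ℝ) < w := Nat.cast_pos.2 hw
  obtain ⟨h0, hle⟩ := logScale_mem_Icc (β := 16 * γ) (by positivity) hw0
    (L.componentEstimate_nonneg s)
  exact ⟨h0, hle.trans ((div_le_iff₀ hw0).2 (L.componentEstimate_le s))⟩

variable {L L'}

theorem abs_componentEstimate_sub_le {s : Samples n w r γ} (hs : s ∉ L.badSamples r γ) :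
    |L.componentEstimate s - G.componentSum| ≤ 16 * γ / 4 * G.componentSum := by
  have h : |L.componentEstimate s - G.componentSum| ≤ 4 * γ * G.componentSum := le_of_not_gt hs
  linarith

theorem logScale_componentEstimate_le_add_one (hGH : G.EdgeNeighboring H) (hw : 1 ≤ w)
    (hγ : 0 < γ) (hγ1 : 16 * γ ≤ 1) {s : Samples n w r γ} (hs : s ∉ L.badSamples r γ)
    (hs' : s ∉ L'.badSamples r γ) :
    logScale (16 * γ) w (L.componentEstimate s) ≤
      logScale (16 * γ) w (L'.componentEstimate s) + 1 :=
  logScale_le_logScale_add_one (by positivity) hγ1 (Nat.cast_pos.2 hw)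
    (L.componentEstimate_nonneg s) (L'.componentEstimate_nonneg s) (Nat.cast_nonneg _)
    (mod_cast hGH.componentSum_le) (abs_componentEstimate_sub_le hs)
    (abs_componentEstimate_sub_le hs')

theorem abs_logScale_componentEstimate_sub_le_one (hGH : G.EdgeNeighboring H) (hw : 1 ≤ w)
    (hγ : 0 < γ) (hγ1 : 16 * γ ≤ 1) {s : Samples n w r γ}
    (hs : s ∉ L.badSamples r γ ∪ L'.badSamples r γ) :
    |logScale (16 * γ) w (L.componentEstimate s) -
      logScale (16 * γ) w (L'.componentEstimate s)| ≤ 1 := by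
  rw [Set.mem_union, not_or] at hs
  rw [abs_sub_le_iff]
  constructor <;> rw [sub_le_iff_le_add']
  · exact logScale_componentEstimate_le_add_one hGH hw hγ hγ1 hs.1 hs.2
  · exact logScale_componentEstimate_le_add_one hGH.symm hw hγ hγ1 hs.2 hs.1

variable [NeZero n]

variable (L) in
theorem measureReal_badSamples_le (hw : 1 ≤ w) (hr : r ≠ 0) (hγ : 0 < γ) (hγ1 : γ ≤ 1) :
    (sampleLaw n (⌊w / γ⌋₊ + 1) (Fin w × Fin r)).real (L.badSamples r γ) ≤
      2 * Real.exp (-(γ ^ 2 * r / 2)) := by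
  refine QueryProg.measureReal_lt_abs_countHits_sub_le L hw hr hγ.le hγ1
    (Nat.floor_le (by positivity)) ?_
  rw [mul_comm, ← div_le_iff₀ hγ]
  exact_mod_cast (Nat.lt_floor_add_one _).le

end WeightedGraph.AdjList

open WeightedGraph.AdjList

variable [NeZero n] {ε : ℝ} {E : ℝ≥0}

theorem probOutput_noisyMST (L : G.AdjList) {S : Set ℝ} (hS : MeasurableSet S) :
    (noisyMST n w r γ ε E).probOutput L S =
      ∫ s : Samples n w r γ,
        (robustLaplace ε n E (logScale (16 * γ) w (L.componentEstimate s))).real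
          ((fun z => expScale (16 * γ) w z - w) ⁻¹' S)
        ∂sampleLaw n (⌊w / γ⌋₊ + 1) (Fin w × Fin r) := by
  rw [noisyMST, QueryAlgorithm.probOutput_ofProg _ _ _ L hS]
  simp only [measureReal_noisyRelease _ _ _ _ _ _ hS]
  rfl

theorem isEdgeDP_noisyMST (hw : 1 ≤ w) (hr : r ≠ 0) (hγ : 0 < γ) (hγ1 : 16 * γ ≤ 1) (hε : 0 < ε)
    (hE : E * (4 * Real.exp (-(γ ^ 2 * r / 2))) * (Real.exp ε * (n + 1)) ≤ Real.exp ε - 1) :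
    (noisyMST n w r γ ε E).IsEdgeDP ε := by
  intro G H hGH L L' S hS
  rw [probOutput_noisyMST L hS, probOutput_noisyMST L' hS]
  have hbad : (sampleLaw n (⌊w / γ⌋₊ + 1) (Fin w × Fin r)).real
      (L.badSamples r γ ∪ L'.badSamples r γ) ≤ 4 * Real.exp (-(γ ^ 2 * r / 2)) := by
    refine (measureReal_union_le _ _).trans ?_
    linarith [L.measureReal_badSamples_le hw hr hγ (by linarith),
      L'.measureReal_badSamples_le hw hr hγ (by linarith)]
  refine integral_robustLaplace_le_exp_mul hε (L.logScale_componentEstimate_mem_Icc hγ hw)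
    (fun s hs => abs_logScale_componentEstimate_sub_le_one hGH hw hγ hγ1 hs) (le_trans ?_ hE) _
  gcongr

theorem le_probOutput_noisyMST (L : G.AdjList) (hG : G.graph.Connected) (hw : 1 ≤ w)
    (hwn : 2 * w ≤ n) (hr : r ≠ 0) (hγ : 0 < γ) (hε : 0 < ε) {α s : ℝ} (hα : α ≤ 1)
    (hγα : 16 * γ ≤ α / 4) (hs : 0 ≤ s) (hsα : 16 * γ * s ≤ α / 8) {S : Set ℝ}
    (hS : MeasurableSet S)
    (hSmem : ∀ y : ℝ, |y - G.mstWeight| ≤ α * G.mstWeight + 4 / 3 * (w * s) → y ∈ S) :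
    1 - 1 / (E + 1) - Real.exp (-(ε * s)) - 2 * Real.exp (-(γ ^ 2 * r / 2)) ≤
      (noisyMST n w r γ ε E).probOutput L S := by
  have hM := G.mstWeight_add_eq_componentSum hG
  have hwM : w ≤ G.mstWeight := by have := G.le_componentSum hw; omega
  rw [probOutput_noisyMST L hS]
  refine le_trans (sub_le_sub_left (L.measureReal_badSamples_le hw hr hγ (by linarith)) _)
    (le_integral_robustLaplace hε hs n E (hS.preimage (measurable_expScale_sub _ _))
      fun x hx z hz => hSmem _ ?_)
  have hclose := abs_componentEstimate_sub_le hx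
  rw [← hM, Nat.cast_add] at hclose
  exact abs_expScale_sub_sub_le (by positivity) (Nat.cast_pos.2 hw) hα hγα hs hsα
    (Nat.cast_le.2 hwM) (L.componentEstimate_nonneg x) hclose hz

theorem le_probQueriesLE_noisyMST (L : G.AdjList) (hw : w ≠ 0) (hr : r ≠ 0) {b : ℝ}
    (hγr : 1 ≤ γ * r)
    (hb : 2 * (w * r) + 4 * (w * r * ((G.avgDegree + 1) *
      (1 + Real.log (⌊w / γ⌋₊ + 1 : ℕ)))) ≤ b) :
    1 - Real.exp (-(⌊γ * r⌋₊ / 2 : ℝ)) ≤ (noisyMST n w r γ ε E).probQueriesLE L b := by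
  rw [noisyMST, QueryAlgorithm.probQueriesLE_ofProg, sub_le_comm,
    ← probReal_compl_eq_one_sub .of_discrete]
  refine le_trans (measureReal_mono fun s hs => ?_)
    (QueryProg.measureReal_lt_cost_countHits_le L hw hr (Nat.floor_pos.2 hγr) hb)
  simpa [sampleHits] using hs

end Mechanism

section Parameters

open scoped NNReal

theorem one_le_log_natCast {n : ℕ} (hn : 3 ≤ n) : 1 ≤ Real.log n := by
  have hn' : (3 : ℝ) ≤ n := Nat.ofNat_le_cast.2 hn
  rw [Real.le_log_iff_exp_le (by linarith)]
  linarith [Real.exp_one_lt_three]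

theorem exp_neg_mul_log_natCast {n : ℕ} (hn : n ≠ 0) (c : ℝ) :
    Real.exp (-(c * Real.log n)) = 1 / (n : ℝ) ^ c := by
  rw [Real.rpow_def_of_pos (by positivity), Real.exp_neg, one_div, mul_comm]

theorem WeightedGraph.one_le_avgDegree {n w : ℕ} (G : WeightedGraph n w) (hn : 2 ≤ n)
    (hG : G.graph.Connected) : 1 ≤ G.avgDegree := by
  have hedges := hG.card_vert_le_card_edgeSet_add_one
  rw [Nat.card_fin, Nat.card_coe_set_eq] at hedges
  rw [avgDegree, le_div_iff₀ (by positivity)]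
  have : n ≤ 2 * G.graph.edgeSet.ncard := by omega
  exact_mod_cast (one_mul n).trans_le this

/-- The proportion `γ` of hits that the sampling may lose or misjudge. -/
noncomputable def samplingError (A ε α : ℝ) (n : ℕ) : ℝ := α * ε / (16 * A * Real.log n)

/-- The number of samples per threshold for which sampling errors above `γ` have a probability of
order `1 / n ^ ρ`. -/
noncomputable def numSamples (ρ γ : ℝ) (n : ℕ) : ℕ := ⌈2 * ρ * Real.log n / γ ^ 2⌉₊

/-- The weight of the Laplace noise relative to the Laplace grid. -/
noncomputable def noiseRatio (c ε : ℝ) (K n : ℕ) : ℝ≥0 :=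
  ((n : ℝ) ^ (c - 3) * (Real.exp ε - 1) / K).toNNReal

/-- The factor in front of the query bound of `privateMST`. -/
noncomputable def queryConst (A ρ : ℝ) : ℝ :=
  (2 * ρ + 1) * (256 * A ^ 2) * (2 + 8 * (2 + |Real.log (32 * A)|))

/-- The private estimator `noisyMST` with its parameters expressed through those of the problem. -/
noncomputable def privateMST (c A D ε α : ℝ) (K n w : ℕ) [NeZero n] : QueryAlgorithm n w :=
  noisyMST n w (numSamples (c + D) (samplingError A ε α n) n) (samplingError A ε α n) ε
    (noiseRatio c ε K n)

variable {c A D ε α ρ γ : ℝ} {K n w : ℕ}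

theorem samplingError_pos (hA : 0 < A) (hε : 0 < ε) (hα : 0 < α) (hn : 3 ≤ n) :
    0 < samplingError A ε α n := by
  have := one_le_log_natCast hn
  unfold samplingError
  positivity

theorem sixteen_mul_samplingError_le (hε : 0 < ε) (hεA : 4 * ε ≤ A) (hα : 0 ≤ α) (hn : 3 ≤ n) :
    16 * samplingError A ε α n ≤ α / 4 := by
  have hℓ := one_le_log_natCast hn
  have hA : 0 < A := by linarith
  calc 16 * samplingError A ε α n = α * (4 * ε / (A * Real.log n)) / 4 := by
        unfold samplingError
        field_simp
    _ ≤ α / 4 := by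
        gcongr
        refine mul_le_of_le_one_right hα ((div_le_one (by positivity)).2 ?_)
        exact hεA.trans (le_mul_of_one_le_right hA.le hℓ)

theorem sixteen_mul_samplingError_mul_le (hA : 0 < A) (hcA : 12 * c ≤ A) (hε : 0 < ε)
    (hα : 0 ≤ α) (hn : 3 ≤ n) :
    16 * samplingError A ε α n * (3 / 2 * c * Real.log n / ε) ≤ α / 8 := by
  have hℓ := one_le_log_natCast hn
  calc 16 * samplingError A ε α n * (3 / 2 * c * Real.log n / ε) = α * (12 * c / A) / 8 := by
        unfold samplingError
        field_simp
        ring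
    _ ≤ α / 8 := by
        gcongr
        exact mul_le_of_le_one_right hα ((div_le_one hA).2 hcA)

theorem numSamples_ne_zero (hρ : 0 < ρ) (hγ : 0 < γ) (hn : 3 ≤ n) : numSamples ρ γ n ≠ 0 := by
  have := one_le_log_natCast hn
  exact (Nat.ceil_pos.2 (by positivity)).ne'

theorem two_mul_log_le_sq_mul_numSamples (hγ : 0 < γ) :
    2 * ρ * Real.log n ≤ γ ^ 2 * numSamples ρ γ n := by
  rw [← div_le_iff₀' (by positivity)]
  exact Nat.le_ceil _

theorem exp_neg_sq_mul_numSamples_le (hγ : 0 < γ) (hD : 0 ≤ D) (hn : 3 ≤ n) :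
    Real.exp (-(γ ^ 2 * numSamples (c + D) γ n / 2)) ≤ 1 / (n : ℝ) ^ c * Real.exp (-D) := by
  have hℓ := one_le_log_natCast hn
  have hr := two_mul_log_le_sq_mul_numSamples (ρ := c + D) (n := n) hγ
  rw [← exp_neg_mul_log_natCast (by omega), ← Real.exp_add]
  gcongr
  linarith [le_mul_of_one_le_right hD hℓ]

theorem coe_noiseRatio (hε : 0 ≤ ε) :
    (noiseRatio c ε K n : ℝ) = (n : ℝ) ^ (c - 3) * (Real.exp ε - 1) / K := by
  have : 0 ≤ Real.exp ε - 1 := sub_nonneg.2 (Real.one_le_exp hε)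
  exact Real.coe_toNNReal _ (by positivity)

theorem noiseRatio_mul_le (hε : 0 ≤ ε) (hK : 0 < K) (hn : 2 ≤ n) :
    noiseRatio c ε K n * (1 / (n : ℝ) ^ c) * (n + 1) ≤ Real.exp ε - 1 := by
  have hexp : 0 ≤ Real.exp ε - 1 := sub_nonneg.2 (Real.one_le_exp hε)
  have hcube : (n + 1 : ℝ) ≤ n ^ 3 := by
    have : (2 : ℝ) ≤ n := Nat.ofNat_le_cast.2 hn
    nlinarith [mul_le_mul this this zero_le_two (by positivity)]
  have hpow : (n : ℝ) ^ (c - 3) * (1 / (n : ℝ) ^ c) * (n + 1) ≤ 1 := by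
    rw [Real.rpow_sub (by positivity)]
    calc (n : ℝ) ^ c / (n : ℝ) ^ (3 : ℝ) * (1 / (n : ℝ) ^ c) * (n + 1) = (n + 1) / n ^ 3 := by
          field_simp
          norm_cast
      _ ≤ 1 := (div_le_one (by positivity)).2 hcube
  calc noiseRatio c ε K n * (1 / (n : ℝ) ^ c) * (n + 1)
      = (n : ℝ) ^ (c - 3) * (1 / (n : ℝ) ^ c) * (n + 1) * ((Real.exp ε - 1) / K) := by
        rw [coe_noiseRatio hε]
        ring
    _ ≤ 1 * ((Real.exp ε - 1) / K) := by gcongr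
    _ ≤ Real.exp ε - 1 := by
        rw [one_mul]
        exact div_le_self hexp (Nat.one_le_cast.2 hK)

theorem exists_one_le_and_exp_neg_le {a b : ℝ} (ha : 0 < a) (hb : 0 < b) :
    ∃ D : ℝ, 1 ≤ D ∧ Real.exp (-D) ≤ a ∧ Real.exp (-D) ≤ b := by
  have h := Real.tendsto_exp_neg_atTop_nhds_zero
  exact ((Filter.eventually_ge_atTop 1).and
    ((h.eventually_le_const ha).and (h.eventually_le_const hb))).exists

theorem exp_neg_add_two_mul_exp_neg_le (hc : 0 < c) (hD : 0 ≤ D)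
    (hDc : 2 * Real.exp (-D) ≤ 1 - Real.exp (-(c / 2))) (hγ : 0 < γ) (hε : ε ≠ 0) (hn : 3 ≤ n) :
    Real.exp (-(ε * (3 / 2 * c * Real.log n / ε))) +
        2 * Real.exp (-(γ ^ 2 * numSamples (c + D) γ n / 2)) ≤ 1 / (n : ℝ) ^ c := by
  have hnoise : Real.exp (-(ε * (3 / 2 * c * Real.log n / ε))) ≤
      1 / (n : ℝ) ^ c * Real.exp (-(c / 2)) := by
    rw [mul_div_cancel₀ _ hε, ← exp_neg_mul_log_natCast (by omega), ← Real.exp_add]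
    gcongr
    linarith [le_mul_of_one_le_right hc.le (one_le_log_natCast hn)]
  calc Real.exp (-(ε * (3 / 2 * c * Real.log n / ε))) +
        2 * Real.exp (-(γ ^ 2 * numSamples (c + D) γ n / 2))
      ≤ 1 / (n : ℝ) ^ c * Real.exp (-(c / 2)) + 2 * (1 / (n : ℝ) ^ c * Real.exp (-D)) := by
        gcongr
        exact exp_neg_sq_mul_numSamples_le hγ hD hn
    _ = 1 / (n : ℝ) ^ c * (Real.exp (-(c / 2)) + 2 * Real.exp (-D)) := by ring
    _ ≤ 1 / (n : ℝ) ^ c := mul_le_of_le_one_right (by positivity) (by linarith)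

theorem numSamples_le (hρ : 0 ≤ ρ) (hA : 0 < A) (hε : 0 < ε) (hα : 0 < α) (hn : 3 ≤ n)
    (hγ1 : samplingError A ε α n ≤ 1) :
    numSamples ρ (samplingError A ε α n) n ≤
      (2 * ρ + 1) * (256 * A ^ 2) * (Real.log n ^ 3 / (α ^ 2 * ε ^ 2)) := by
  have hℓ := one_le_log_natCast hn
  have hγ := samplingError_pos hA hε hα hn
  set γ := samplingError A ε α n with hγ_def
  have hone : 1 ≤ Real.log n / γ ^ 2 := by
    rw [le_div_iff₀ (by positivity), one_mul]
    exact (pow_le_one₀ hγ.le hγ1).trans hℓ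
  calc (numSamples ρ γ n : ℝ) ≤ 2 * ρ * Real.log n / γ ^ 2 + 1 :=
        (Nat.ceil_lt_add_one (by positivity)).le
    _ ≤ 2 * ρ * Real.log n / γ ^ 2 + Real.log n / γ ^ 2 := by gcongr
    _ = (2 * ρ + 1) * (Real.log n / γ ^ 2) := by ring
    _ = _ := by
        rw [hγ_def, samplingError]
        field_simp
        norm_num

theorem floor_div_samplingError_add_one_le {d : ℝ} (hd : 1 ≤ d) (hA : 0 < A) (hε : 0 < ε)
    (hα : 0 < α) (hn : 3 ≤ n) (hw : 1 ≤ w) (hγ1 : samplingError A ε α n ≤ 1) :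
    (⌊w / samplingError A ε α n⌋₊ + 1 : ℕ) ≤ 32 * A * (d * w * Real.log n / (α * ε)) := by
  have hℓ := one_le_log_natCast hn
  have hγ := samplingError_pos hA hε hα hn
  set γ := samplingError A ε α n with hγ_def
  have hone : 1 ≤ w / γ := by
    rw [one_le_div hγ]
    exact hγ1.trans (Nat.one_le_cast.2 hw)
  calc ((⌊w / γ⌋₊ + 1 : ℕ) : ℝ) ≤ w / γ + w / γ := by
        push_cast
        exact add_le_add (Nat.floor_le (by positivity)) hone
    _ = 32 * A * (1 * w * Real.log n / (α * ε)) := by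
        rw [hγ_def, samplingError]
        field_simp
        norm_num
    _ ≤ _ := by gcongr

theorem one_add_log_le {Q B X : ℝ} (hQ : 0 < Q) (hB : B ≠ 0) (hX : 3 ≤ X) (hQX : Q ≤ B * X) :
    1 + Real.log Q ≤ (2 + |Real.log B|) * Real.log X := by
  have hX0 : X ≠ 0 := by linarith
  have hlogX : 1 ≤ Real.log X := by
    rw [Real.le_log_iff_exp_le (by linarith)]
    linarith [Real.exp_one_lt_three]
  calc 1 + Real.log Q ≤ 1 + (|Real.log B| + Real.log X) := by
        grw [Real.log_le_log hQ hQX, Real.log_mul hB hX0, ← le_abs_self (Real.log B)]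
    _ ≤ (2 + |Real.log B|) * Real.log X := by
        nlinarith [le_mul_of_one_le_right (abs_nonneg (Real.log B)) hlogX]

theorem two_mul_add_four_mul_le {w r R d q B ℓ : ℝ} (hw : 0 ≤ w) (hr : 0 ≤ r) (hrR : r ≤ R)
    (hd : 1 ≤ d) (hB : 0 ≤ B) (hℓ : 1 ≤ ℓ) (hq : q ≤ B * ℓ) :
    2 * (w * r) + 4 * (w * r * ((d + 1) * q)) ≤ (2 + 8 * B) * (d * w * R * ℓ) := by
  have hR : 0 ≤ R := hr.trans hrR
  have hdq : (d + 1) * q ≤ (d + d) * (B * ℓ) := by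
    calc (d + 1) * q ≤ (d + 1) * (B * ℓ) := by gcongr
      _ ≤ (d + d) * (B * ℓ) := by gcongr
  have hwr : w * r ≤ w * R * (d * ℓ) := by
    calc w * r ≤ w * R := by gcongr
      _ ≤ w * R * (d * ℓ) :=
        le_mul_of_one_le_right (by positivity) (one_le_mul_of_one_le_of_one_le hd hℓ)
  calc 2 * (w * r) + 4 * (w * r * ((d + 1) * q))
      ≤ 2 * (w * r) + 4 * (w * r * ((d + d) * (B * ℓ))) := by gcongr
    _ ≤ 2 * (w * R * (d * ℓ)) + 4 * (w * R * ((d + d) * (B * ℓ))) := by gcongr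
    _ = _ := by ring

theorem queries_le_queryConst_mul {d : ℝ} (hd : 1 ≤ d) (hρ : 0 ≤ ρ) (hA : 0 < A) (hε : 0 < ε)
    (hα : 0 < α) (hα1 : α ≤ 1) (hn : 3 ≤ n) (hεn : 3 * ε ≤ Real.log n) (hw : 1 ≤ w)
    (hγ1 : samplingError A ε α n ≤ 1) :
    2 * (w * (numSamples ρ (samplingError A ε α n) n : ℝ)) +
        4 * (w * (numSamples ρ (samplingError A ε α n) n : ℝ) *
          ((d + 1) * (1 + Real.log (⌊w / samplingError A ε α n⌋₊ + 1 : ℕ)))) ≤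
      queryConst A ρ * (d * w * (Real.log n ^ 3 / (α ^ 2 * ε ^ 2)) *
        Real.log (d * w * Real.log n / (α * ε))) := by
  have hℓ := one_le_log_natCast hn
  have hX : 3 ≤ d * w * Real.log n / (α * ε) := by
    rw [le_div_iff₀ (by positivity)]
    have hdw : 1 ≤ d * w := one_le_mul_of_one_le_of_one_le hd (Nat.one_le_cast.2 hw)
    calc 3 * (α * ε) ≤ 3 * ε := by nlinarith
      _ ≤ 1 * Real.log n := by linarith
      _ ≤ d * w * Real.log n := by gcongr
  have hlogX : 1 ≤ Real.log (d * w * Real.log n / (α * ε)) := by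
    rw [Real.le_log_iff_exp_le (by linarith)]
    linarith [Real.exp_one_lt_three]
  have hQ := one_add_log_le (Nat.cast_pos.2 (Nat.succ_pos _)) (by positivity) hX
    (floor_div_samplingError_add_one_le hd hA hε hα hn hw hγ1)
  refine (two_mul_add_four_mul_le w.cast_nonneg (Nat.cast_nonneg _)
    (numSamples_le hρ hA hε hα hn hγ1) hd (by positivity) hlogX hQ).trans_eq ?_
  rw [queryConst]
  ring

variable [NeZero n]

theorem isEdgeDP_privateMST (hc : 0 < c) (hD : 0 ≤ D) (hDε : 4 * Real.exp (-D) * Real.exp ε ≤ 1)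
    (hε : 0 < ε) (hεA : 4 * ε ≤ A) (hα : 0 < α) (hα1 : α ≤ 1) (hK : 0 < K) (hn : 3 ≤ n)
    (hw : 1 ≤ w) : (privateMST c A D ε α K n w).IsEdgeDP ε := by
  have hγ := samplingError_pos (by linarith : 0 < A) hε hα hn
  refine isEdgeDP_noisyMST hw (numSamples_ne_zero (by linarith) hγ hn) hγ
    ((sixteen_mul_samplingError_le hε hεA hα.le hn).trans (by linarith)) hε ?_
  have hexp : 0 ≤ Real.exp ε - 1 := sub_nonneg.2 (Real.one_le_exp hε.le)
  set γ := samplingError A ε α n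
  set E := noiseRatio c ε K n
  calc E * (4 * Real.exp (-(γ ^ 2 * numSamples (c + D) γ n / 2))) * (Real.exp ε * (n + 1))
      ≤ E * (4 * (1 / (n : ℝ) ^ c * Real.exp (-D))) * (Real.exp ε * (n + 1)) := by
        gcongr
        exact exp_neg_sq_mul_numSamples_le hγ hD hn
    _ = E * (1 / (n : ℝ) ^ c) * (n + 1) * (4 * Real.exp (-D) * Real.exp ε) := by ring
    _ ≤ (Real.exp ε - 1) * 1 := by
        gcongr
        exact noiseRatio_mul_le hε.le hK (by omega)
    _ = _ := mul_one _

variable {G : WeightedGraph n w}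

theorem le_probOutput_privateMST (L : G.AdjList) (hG : G.graph.Connected) (hc : 0 < c)
    (hcA : 12 * c ≤ A) (hD : 0 ≤ D) (hDc : 2 * Real.exp (-D) ≤ 1 - Real.exp (-(c / 2)))
    (hε : 0 < ε) (hεA : 4 * ε ≤ A) (hα : 0 < α) (hα1 : α ≤ 1) (hw : 1 ≤ w) (hwn : 2 * w < n)
    {η : ℝ} (hη : 0 ≤ η) :
    1 - 1 / (n : ℝ) ^ c - 1 / ((n : ℝ) ^ (c - 3) * (Real.exp ε - 1) / (K : ℝ) + 1) ≤
      (privateMST c A D ε α K n w).probOutput L (Set.Icc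
        ((1 - α * (1 + ε / (1 * Real.log n))) * (G.mstWeight : ℝ)
          - 2 * c * w * Real.log n / ε - η)
        ((1 + α * (1 + ε / (1 * Real.log n))) * (G.mstWeight : ℝ)
          + 2 * c * w * Real.log n / ε + η)) := by
  have hn : 3 ≤ n := by omega
  have hℓ := one_le_log_natCast hn
  have hA : 0 < A := by linarith
  have hγ := samplingError_pos hA hε hα hn
  refine le_trans ?_ (le_probOutput_noisyMST (s := 3 / 2 * c * Real.log n / ε) L hG hw hwn.le
    (numSamples_ne_zero (by linarith) hγ hn) hγ hε hα1
    (sixteen_mul_samplingError_le hε hεA hα.le hn) (by positivity)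
    (sixteen_mul_samplingError_mul_le hA hcA hε hα.le hn) measurableSet_Icc fun y hy => ?_)
  · rw [coe_noiseRatio hε.le]
    linarith [exp_neg_add_two_mul_exp_neg_le hc hD hDc hγ hε.ne' hn]
  · have hnoise : 4 / 3 * (w * (3 / 2 * c * Real.log n / ε)) = 2 * c * w * Real.log n / ε := by
      ring
    have hslack : 0 ≤ α * (ε / (1 * Real.log n)) * (G.mstWeight : ℝ) := by positivity
    rw [hnoise, abs_le] at hy
    constructor <;> linarith [hy.1, hy.2]

theorem le_probQueriesLE_privateMST (L : G.AdjList) (hG : G.graph.Connected) (hc : 0 < c)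
    (hD : 1 ≤ D) (hε : 0 < ε) (hεA : 4 * ε ≤ A) (hεn : 3 * ε ≤ Real.log n) (hα : 0 < α)
    (hα1 : α ≤ 1) (hn : 3 ≤ n) (hw : 1 ≤ w) :
    1 - 1 / (n : ℝ) ^ c ≤ (privateMST c A D ε α K n w).probQueriesLE L
      (queryConst A (c + D) * (G.avgDegree * w * (Real.log n ^ 3 / (α ^ 2 * ε ^ 2)) *
        Real.log (G.avgDegree * w * Real.log n / (α * ε)))) := by
  have hℓ := one_le_log_natCast hn
  have hA : 0 < A := by linarith
  have hγ := samplingError_pos hA hε hα hn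
  have hγα := sixteen_mul_samplingError_le hε hεA hα.le hn
  have hγr : 2 * (c * Real.log n) + 1 ≤
      samplingError A ε α n * numSamples (c + D) (samplingError A ε α n) n := by
    set γ := samplingError A ε α n
    calc 2 * (c * Real.log n) + 1 ≤ 2 * (c + D) * Real.log n := by nlinarith
      _ ≤ γ ^ 2 * numSamples (c + D) γ n := two_mul_log_le_sq_mul_numSamples hγ
      _ ≤ γ * numSamples (c + D) γ n := by
          gcongr
          exact pow_le_of_le_one hγ.le (by linarith) two_ne_zero
  have hcℓ : 0 ≤ c * Real.log n := by positivity
  refine le_trans ?_ (le_probQueriesLE_noisyMST L (by omega)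
    (numSamples_ne_zero (by linarith) hγ hn) (by linarith) (queries_le_queryConst_mul
      (G.one_le_avgDegree (by omega) hG) (by linarith) hA hε hα hα1 hn hεn hw (by linarith)))
  rw [← exp_neg_mul_log_natCast (by omega)]
  gcongr
  linarith [Nat.lt_floor_add_one
    (samplingError A ε α n * numSamples (c + D) (samplingError A ε α n) n)]

end Parameters

theorem mainTheorem7 (c ε₀ : ℝ) (hc : 0 < c) (hε₀ : 0 < ε₀) :
    ∃ C' : ℝ, 0 < C' ∧ ∃ C : ℝ, 0 < C ∧ ∃ N : ℕ,
      ∀ K : ℕ, 0 < K → ∀ ε : ℝ, 0 < ε → ε ≤ ε₀ → ∀ α : ℝ, 0 < α → α < 1 →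
      ∀ n w : ℕ, 1 ≤ w → 2 * w < n →
      ∃ A : QueryAlgorithm n w,
        -- privacy
        A.IsEdgeDP ε ∧
        -- accuracy
        (∀ (G : WeightedGraph n w) (L : G.AdjList), G.graph.Connected →
          1 - 1 / (n : ℝ) ^ c - 1 / ((n : ℝ) ^ (c - 3) * (Real.exp ε - 1) / (K : ℝ) + 1) ≤
            A.probOutput L (Set.Icc
              ((1 - α * (1 + ε / (C' * Real.log n))) * (G.mstWeight : ℝ)
                - 2 * c * w * Real.log n / ε - 1 / ((K : ℝ) * (n : ℝ) ^ 3))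
              ((1 + α * (1 + ε / (C' * Real.log n))) * (G.mstWeight : ℝ)
                + 2 * c * w * Real.log n / ε + 1 / ((K : ℝ) * (n : ℝ) ^ 3)))) ∧
        -- number of queries
        (N ≤ n → ∀ (G : WeightedGraph n w) (L : G.AdjList), G.graph.Connected →
          1 - 1 / (n : ℝ) ^ c ≤
            A.probQueriesLE L
              (C * (G.avgDegree * w * (Real.log n ^ 3 / (α ^ 2 * ε ^ 2)) *
                Real.log (G.avgDegree * w * Real.log n / (α * ε))))) := by
  have hexp : Real.exp (-(c / 2)) < 1 := Real.exp_lt_one_iff.2 (by linarith)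
  obtain ⟨D, hD, hDc, hDε₀⟩ := exists_one_le_and_exp_neg_le
    (a := (1 - Real.exp (-(c / 2))) / 2) (b := Real.exp (-ε₀) / 4) (by linarith) (by positivity)
  set A := 4 * ε₀ + 12 * c
  have : A ≠ 0 := by positivity
  refine ⟨1, one_pos, queryConst A (c + D), by unfold queryConst; positivity,
    ⌈Real.exp (3 * ε₀)⌉₊, fun K hK ε hε hεε₀ α hα hα1 n w hw hwn => ?_⟩
  have hn : 3 ≤ n := by omega
  have : NeZero n := ⟨by omega⟩
  have hεA : 4 * ε ≤ A := by linarith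
  have hDε : 4 * Real.exp (-D) * Real.exp ε ≤ 1 := by
    calc 4 * Real.exp (-D) * Real.exp ε ≤ 4 * (Real.exp (-ε₀) / 4) * Real.exp ε₀ := by gcongr
      _ = 1 := by rw [mul_div_cancel₀ _ four_ne_zero, ← Real.exp_add, neg_add_cancel, Real.exp_zero]
  refine ⟨privateMST c A D ε α K n w,
    isEdgeDP_privateMST hc (by linarith) hDε hε hεA hα hα1.le hK hn hw, fun G L hG => ?_,
    fun hN G L hG => ?_⟩
  · exact le_probOutput_privateMST L hG hc (by linarith) (by linarith) (by linarith) hε hεA hα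
      hα1.le hw hwn (by positivity)
  · have hεn : 3 * ε₀ ≤ Real.log n :=
      (Real.le_log_iff_exp_le (by positivity)).2 ((Nat.le_ceil _).trans (Nat.cast_le.2 hN))
    exact le_probQueriesLE_privateMST L hG hc hD hε hεA (by linarith) hα hα1.le hn hw
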